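/- Let $\Sigma=\biguplus_{k\ge 0}\Sigma_k$ be a ranked set. A (Lawvere) theory $T$ is a category with objects $0,1,2,\dots$ in which $n$ is the $n$-fold coproduct of $1$ with distinguished injections $i_n:1\to n$ ($i\in[n]$) and $1_1=\mathbf 1_1$; composition is written in diagrammatic order. An idempotent grove theory is a theory in which every hom-set $T(n,p)$ carries a commutative idempotent monoid structure $(+,0_{n,p})$ such that $i_n\cdot(f+g)=i_n\cdot f+i_n\cdot g$, $i_n\cdot 0_{n,p}=0_{1,p}$, $(f+g)\cdot h=f\cdot h+g\cdot h$ and $0_{n,p}\cdot h=0_{n,q}$. Its hom-sets are ordered by $f\le g\iff f+g=g$. It is $\omega$-continuous if every $\omega$-chain in a hom-set has a supremum and composition preserves suprema of $\omega$-chains in both arguments. For $f:n\to n+p$, $f^\dagger:n\to p$ denotes the least solution of $x=f\cdot\langle x,\mathbf 1_p\rangle$, which exists in every $\omega$-continuous idempotent grove theory. A morphism of idempotent grove theories is a functor that is the identity on objects and preserves the distinguished morphisms $i_n$, the operation $+$ and the constants $0_{n,p}$. A synchronization tree $1\to p$ over $\Sigma$ consists of countable sets of vertices and of edges $e:v\to(v_1,\dots,v_k)$,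 $k\ge 0$, each edge being labeled by a letter of $\Sigma_k$ or, when $k=0$, possibly by one of the exit symbols $\mathsf{ex}_1,\dots,\mathsf{ex}_p$, together with a root from which every vertex is reached by a unique path. It is regular if it has, up to isomorphism, finitely many subtrees and only finitely many letters occur as edge labels. A simulation $t\to t'$ is a relation $R$ between the vertices that relates the roots and is such that whenever $v\mathrel R v'$ and $v\to(v_1,\dots,v_k)$ is an edge of $t$, there is an equally labeled edge $v'\to(v'_1,\dots,v'_k)$ of $t'$ with $v_i\mathrel R v'_i$ for all $i$; trees $t,t'$ are simulation equivalent if there are simulations $t\to t'$ and $t'\to t$. Let $\mathbf{SST}_\Sigma$ be the idempotent grove theory whose morphisms $n\to p$ are the $n$-tuples of simulation equivalence classes of synchronization trees $1\to p$, where $t\cdot(s_1,\dots,s_p)$ replaces each edge of $t$ labeled $\mathsf{ex}_i$ by a copy of $s_i$, $i_n$ is the tree with a single edge, labeled $\mathsf{ex}_i$, the sum merges the roots, and $0_{1,p}$ is the tree without edges. In $\mathbf{SST}_\Sigma$ the least solutions $f^\dagger$ exist, too. Let $\mathbf{SRST}_\Sigma$ be the subtheory of $\mathbf{SST}_\Sigma$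 formed by the (tuples of) classes that contain a regular tree; it is closed under $+$ and $^\dagger$. A letter $\sigma\in\Sigma_n$ is identified with the class of the tree $1\to n$ that has one edge labeled $\sigma$ from the root to vertices $v_1,\dots,v_n$ and an edge labeled $\mathsf{ex}_i$ at each $v_i$. **Corollary.** Let $T$ be an $\omega$-continuous idempotent grove theory and let $\varphi:\Sigma\to T$ be a rank-preserving map, i.e. $\varphi(\sigma)\in T(1,n)$ for $\sigma\in\Sigma_n$. Then there is a unique morphism of idempotent grove theories $\varphi^\sharp:\mathbf{SRST}_\Sigma\to T$ that preserves dagger and satisfies $\varphi^\sharp(\sigma)=\varphi(\sigma)$ for every letter $\sigma$ of $\Sigma$. -/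

import Mathlib

universe u v w

namespace Grove

/-! ## Lawvere theories and grove theories -/

/-- A (Lawvere) theory, as a many-sorted algebra: a category with objects `0, 1, 2, …`
in which `n` is the `n`-fold coproduct of `1` with coproduct injections `inj i : 1 → n`.
Composition is written in diagrammatic order. -/
structure LawvereTheory where
  Hom : ℕ → ℕ → Type v
  comp : ∀ {m n p : ℕ}, Hom m n → Hom n p → Hom m p
  one : ∀ n : ℕ, Hom n n
  inj : ∀ {n : ℕ}, Fin n → Hom 1 n
  tup : ∀ {n p : ℕ}, (Fin n → Hom 1 p) → Hom n p
  comp_assoc : ∀ {m n p q : ℕ} (f : Hom m n) (g : Hom n p) (h : Hom p q),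
    comp (comp f g) h = comp f (comp g h)
  one_comp : ∀ {n p : ℕ} (f : Hom n p), comp (one n) f = f
  comp_one : ∀ {n p : ℕ} (f : Hom n p), comp f (one p) = f
  inj_tup : ∀ {n p : ℕ} (f : Fin n → Hom 1 p) (i : Fin n), comp (inj i) (tup f) = f i
  tup_inj : ∀ {n p : ℕ} (f : Hom n p), tup (fun i => comp (inj i) f) = f
  one_one : one 1 = inj 0

/-- The pairing `⟨f, g⟩ : n + m → p` of `f : n → p` and `g : m → p`. -/
def LawvereTheory.pair (T : LawvereTheory.{v}) {n m p : ℕ} (f : T.Hom n p) (g : T.Hom m p) :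
    T.Hom (n + m) p :=
  T.tup (Fin.append (fun i => T.comp (T.inj i) f) (fun j => T.comp (T.inj j) g))

/-- A grove theory: each hom-set is a commutative monoid, compatibly with the
distinguished morphisms and with composition in the first argument. -/
structure GroveTheory extends LawvereTheory.{v} where
  add : ∀ {n p : ℕ}, Hom n p → Hom n p → Hom n p
  zero : ∀ n p : ℕ, Hom n p
  add_assoc : ∀ {n p : ℕ} (f g h : Hom n p), add (add f g) h = add f (add g h)
  add_comm : ∀ {n p : ℕ} (f g : Hom n p), add f g = add g f
  zero_add : ∀ {n p : ℕ} (f : Hom n p), add (zero n p) f = f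
  inj_add : ∀ {n p : ℕ} (i : Fin n) (f g : Hom n p),
    comp (inj i) (add f g) = add (comp (inj i) f) (comp (inj i) g)
  inj_zero : ∀ {n p : ℕ} (i : Fin n), comp (inj i) (zero n p) = zero 1 p
  add_comp : ∀ {n p q : ℕ} (f g : Hom n p) (h : Hom p q),
    comp (add f g) h = add (comp f h) (comp g h)
  zero_comp : ∀ {n p q : ℕ} (h : Hom p q), comp (zero n p) h = zero n q

/-- An idempotent grove theory. -/
structure IdemGroveTheory extends GroveTheory.{v} where
  add_self : ∀ {n p : ℕ} (f : Hom n p), add f f = f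

namespace IdemGroveTheory

/-- The partial order of an idempotent grove theory: `f ≤ g` iff `f + g = g`. -/
instance homPartialOrder (T : IdemGroveTheory.{v}) (n p : ℕ) : PartialOrder (T.Hom n p) where
  le f g := T.add f g = g
  le_refl f := T.add_self f
  le_trans f g h hfg hgh := by
    rw [← hgh, ← T.add_assoc, hfg]
  le_antisymm f g hfg hgf := by
    have h1 : T.add f g = g := hfg
    have h2 : T.add g f = f := hgf
    rw [← h1, T.add_comm, h2]

/-- `ω`-continuity: every `ω`-chain of morphisms has a supremum, and composition preserves
suprema of `ω`-chains in both arguments. -/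
structure IsOmegaContinuous (T : IdemGroveTheory.{v}) : Prop where
  exists_sup : ∀ {n p : ℕ} (f : ℕ → T.Hom n p), Monotone f → ∃ s, IsLUB (Set.range f) s
  sup_comp : ∀ {n p q : ℕ} (f : ℕ → T.Hom n p) (s : T.Hom n p) (g : T.Hom p q), Monotone f →
    IsLUB (Set.range f) s → IsLUB (Set.range fun k => T.comp (f k) g) (T.comp s g)
  comp_sup : ∀ {n p q : ℕ} (g : T.Hom n p) (f : ℕ → T.Hom p q) (s : T.Hom p q), Monotone f →
    IsLUB (Set.range f) s → IsLUB (Set.range fun k => T.comp g (f k)) (T.comp g s)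

/-- The solutions of the fixed point equation `x = f · ⟨x, 1_p⟩`. -/
def fixedPoints (T : IdemGroveTheory.{v}) {n p : ℕ} (f : T.Hom n (n + p)) : Set (T.Hom n p) :=
  {x | x = T.comp f (T.pair x (T.one p))}

open Classical in
/-- The dagger operation: `f†` is the least solution of `x = f · ⟨x, 1_p⟩`.
The value is arbitrary when there is no least solution; it is shown below that there is one
in every `ω`-continuous idempotent grove theory and in the theories of synchronization trees. -/
noncomputable def dagger (T : IdemGroveTheory.{v}) {n p : ℕ} (f : T.Hom n (n + p)) : T.Hom n p :=
  if h : ∃ x, IsLeast (T.fixedPoints f) x then h.choose else T.zero n p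

theorem dagger_eq (T : IdemGroveTheory.{v}) {n p : ℕ} {f : T.Hom n (n + p)} {x : T.Hom n p}
    (hx : IsLeast (T.fixedPoints f) x) : T.dagger f = x := by
  have h : ∃ x, IsLeast (T.fixedPoints f) x := ⟨x, hx⟩
  rw [dagger, dif_pos h]
  exact h.choose_spec.unique hx

/-- A morphism of idempotent grove theories: a functor that is the identity on objects and
preserves the distinguished morphisms, `+` and the constants `0_{n,p}`. -/
structure Morphism (S : IdemGroveTheory.{v}) (T : IdemGroveTheory.{w}) where
  map : ∀ {n p : ℕ}, S.Hom n p → T.Hom n p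
  map_one : ∀ n : ℕ, map (S.one n) = T.one n
  map_comp : ∀ {n p q : ℕ} (f : S.Hom n p) (g : S.Hom p q),
    map (S.comp f g) = T.comp (map f) (map g)
  map_inj : ∀ {n : ℕ} (i : Fin n), map (S.inj i) = T.inj i
  map_add : ∀ {n p : ℕ} (f g : S.Hom n p), map (S.add f g) = T.add (map f) (map g)
  map_zero : ∀ n p : ℕ, map (S.zero n p) = T.zero n p

/-- A morphism preserves dagger. -/
def Morphism.PreservesDagger {S : IdemGroveTheory.{v}} {T : IdemGroveTheory.{w}}
    (F : Morphism S T) : Prop :=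
  ∀ {n p : ℕ} (f : S.Hom n (n + p)), F.map (S.dagger f) = T.dagger (F.map f)

theorem zero_le (T : IdemGroveTheory.{v}) {n p : ℕ} (f : T.Hom n p) : T.zero n p ≤ f :=
  T.zero_add f

theorem inj_comp_mono (T : IdemGroveTheory.{v}) {n p : ℕ} {f g : T.Hom n p} (h : f ≤ g)
    (i : Fin n) : T.comp (T.inj i) f ≤ T.comp (T.inj i) g := by
  change T.add _ _ = _
  rw [← T.inj_add]
  exact congrArg _ h

theorem hom_ext (T : IdemGroveTheory.{v}) {n p : ℕ} {f g : T.Hom n p}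
    (h : ∀ i, T.comp (T.inj i) f = T.comp (T.inj i) g) : f = g := by
  rw [← T.tup_inj f, ← T.tup_inj g]
  exact congrArg T.tup (funext h)

theorem le_of_inj (T : IdemGroveTheory.{v}) {n p : ℕ} {f g : T.Hom n p}
    (h : ∀ i, T.comp (T.inj i) f ≤ T.comp (T.inj i) g) : f ≤ g := by
  change T.add _ _ = _
  refine T.hom_ext fun i => ?_
  rw [T.inj_add]
  exact h i

theorem inj_pair_left (T : IdemGroveTheory.{v}) {n m p : ℕ} (f : T.Hom n p) (g : T.Hom m p)
    (i : Fin n) : T.comp (T.inj (Fin.castAdd m i)) (T.pair f g) = T.comp (T.inj i) f := by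
  rw [LawvereTheory.pair, T.inj_tup, Fin.append_left]

theorem inj_pair_right (T : IdemGroveTheory.{v}) {n m p : ℕ} (f : T.Hom n p) (g : T.Hom m p)
    (i : Fin m) : T.comp (T.inj (Fin.natAdd n i)) (T.pair f g) = T.comp (T.inj i) g := by
  rw [LawvereTheory.pair, T.inj_tup, Fin.append_right]

theorem pair_mono (T : IdemGroveTheory.{v}) {n m p : ℕ} {f f' : T.Hom n p} (h : f ≤ f')
    (g : T.Hom m p) : T.pair f g ≤ T.pair f' g := by
  refine T.le_of_inj fun i => ?_
  refine Fin.addCases (fun i => ?_) (fun i => ?_) i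
  · rw [inj_pair_left, inj_pair_left]
    exact T.inj_comp_mono h i
  · rw [inj_pair_right, inj_pair_right]

namespace IsOmegaContinuous

variable {T : IdemGroveTheory.{v}}

theorem comp_mono (hT : T.IsOmegaContinuous) {n p q : ℕ} (g : T.Hom n p) {f f' : T.Hom p q}
    (h : f ≤ f') : T.comp g f ≤ T.comp g f' := by
  have hm : Monotone (fun k : ℕ => if k = 0 then f else f') := by
    intro a b hab
    by_cases ha : a = 0
    · by_cases hb : b = 0
      · simp [ha, hb]
      · simpa [ha, hb] using h
    · have hb : b ≠ 0 := by omega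
      simp [ha, hb]
  have hl : IsLUB (Set.range (fun k : ℕ => if k = 0 then f else f')) f' := by
    constructor
    · rintro _ ⟨k, rfl⟩
      by_cases hk : k = 0
      · simpa [hk] using h
      · simp [hk]
    · intro b hb
      exact hb ⟨1, by simp⟩
  exact (hT.comp_sup g _ _ hm hl).1 ⟨0, by simp⟩

/-- In an `ω`-continuous idempotent grove theory, least solutions exist. -/
theorem dagger_isLeast (hT : T.IsOmegaContinuous) {n p : ℕ} (f : T.Hom n (n + p)) :
    IsLeast (T.fixedPoints f) (T.dagger f) := by
  let Φ : T.Hom n p → T.Hom n p := fun x => T.comp f (T.pair x (T.one p))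
  have hΦ : Monotone Φ := fun x y h => hT.comp_mono f (T.pair_mono h _)
  let a : ℕ → T.Hom n p := fun k => Φ^[k] (T.zero n p)
  have ha1 : ∀ k, a (k + 1) = Φ (a k) := fun k => Function.iterate_succ_apply' Φ k _
  have ha : Monotone a := by
    refine monotone_nat_of_le_succ fun k => ?_
    induction k with
    | zero => exact T.zero_le _
    | succ k ih =>
      rw [ha1 k, ha1 (k + 1)]
      exact hΦ ih
  obtain ⟨s, hs⟩ := hT.exists_sup a ha
  have hpair : IsLUB (Set.range fun k => T.pair (a k) (T.one p)) (T.pair s (T.one p)) := by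
    constructor
    · rintro _ ⟨k, rfl⟩
      exact T.pair_mono (hs.1 ⟨k, rfl⟩) _
    · intro b hb
      refine T.le_of_inj fun i => ?_
      refine Fin.addCases (fun i => ?_) (fun i => ?_) i
      · rw [inj_pair_left]
        refine (hT.comp_sup (T.inj i) a s ha hs).2 ?_
        rintro _ ⟨k, rfl⟩
        have := T.inj_comp_mono (hb ⟨k, rfl⟩) (Fin.castAdd p i)
        rwa [inj_pair_left] at this
      · have := T.inj_comp_mono (hb ⟨0, rfl⟩) (Fin.natAdd n i)
        rwa [inj_pair_right] at this ⊢
  have hcomp : IsLUB (Set.range fun k => a (k + 1)) (Φ s) := by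
    have := hT.comp_sup f _ _ (fun i j h => T.pair_mono (ha h) (T.one p)) hpair
    simp only [ha1]
    exact this
  have hfix : s = Φ s := by
    refine hs.unique ⟨?_, fun b hb => hcomp.2 ?_⟩
    · rintro _ ⟨k, rfl⟩
      exact (ha (Nat.le_succ k)).trans (hcomp.1 ⟨k, rfl⟩)
    · rintro _ ⟨k, rfl⟩
      exact hb ⟨k + 1, rfl⟩
  have hleast : IsLeast (T.fixedPoints f) s := by
    refine ⟨hfix, fun x hx => hs.2 ?_⟩
    rintro _ ⟨k, rfl⟩
    induction k with
    | zero => exact T.zero_le _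
    | succ k ih =>
      rw [ha1 k]
      have h2 := hΦ ih
      have hx' : x = Φ x := hx
      rwa [← hx'] at h2
  rw [T.dagger_eq hleast]
  exact hleast

end IsOmegaContinuous

end IdemGroveTheory

/-! ## Synchronization trees -/

/-- Edge labels: the letters of the ranked set `Sg`, and the exit symbols `ex_1, …, ex_p`. -/
inductive Label (Sg : ℕ → Type u) (p : ℕ) : Type u
  | letter (σ : Σ n, Sg n) : Label Sg p
  | exit (i : Fin p) : Label Sg p

/-- The number of target vertices of an edge with a given label. -/
def Label.rank {Sg : ℕ → Type u} {p : ℕ} : Label Sg p → ℕ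
  | .letter σ => σ.1
  | .exit _ => 0

/-- The letter that a label other than an exit symbol consists of. -/
def Label.getLetter {Sg : ℕ → Type u} {p : ℕ} :
    (a : Label Sg p) → (∀ i, a ≠ .exit i) → Σ n, Sg n
  | .letter σ, _ => σ
  | .exit i, h => (h i rfl).elim

theorem Label.letter_getLetter {Sg : ℕ → Type u} {p : ℕ} (a : Label Sg p)
    (h : ∀ i, a ≠ .exit i) : .letter (a.getLetter h) = a := by
  cases a with
  | letter σ => rfl
  | exit i => exact absurd rfl (h i)

/-- A countable rooted hyper graph whose edges `e : v → (v_1, …, v_n)` are labeled by letters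
of rank `n`, or by exit symbols when `n = 0`. -/
structure SyncGraph (Sg : ℕ → Type u) (p : ℕ) where
  V : Type
  E : Type
  countable_V : Countable V
  countable_E : Countable E
  root : V
  src : E → V
  lab : E → Label Sg p
  tgt : E → List V
  length_tgt : ∀ e, (tgt e).length = (lab e).rank

namespace SyncGraph

variable {Sg : ℕ → Type u} {p q r n : ℕ}

/-- `G.IsPath v l w`: the list `l` of pairs (edge, position of a target of this edge) is a path
from `v` to `w`. -/
def IsPath (G : SyncGraph Sg p) : G.V → List (G.E × ℕ) → G.V → Prop
  | v, [], w => v = w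
  | v, (e, i) :: l, w => G.src e = v ∧ ∃ x, (G.tgt e)[i]? = some x ∧ G.IsPath x l w

/-- `G.Reach v w`: the vertex `w` is accessible from `v`. -/
def Reach (G : SyncGraph Sg p) : G.V → G.V → Prop :=
  Relation.ReflTransGen fun v w => ∃ e, G.src e = v ∧ w ∈ G.tgt e

theorem reach_tgt (G : SyncGraph Sg p) {v : G.V} {e : G.E} (h : G.Reach v (G.src e)) {w : G.V}
    (hw : w ∈ G.tgt e) : G.Reach v w :=
  h.tail ⟨e, rfl, hw⟩

/-- The part `G|_v` spanned by the vertices accessible from `v`, with root `v`. -/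
def sub (G : SyncGraph Sg p) (v : G.V) : SyncGraph Sg p where
  V := {w : G.V // G.Reach v w}
  E := {e : G.E // G.Reach v (G.src e)}
  countable_V := have := G.countable_V; inferInstance
  countable_E := have := G.countable_E; inferInstance
  root := ⟨v, Relation.ReflTransGen.refl⟩
  src e := ⟨G.src e.1, e.2⟩
  lab e := G.lab e.1
  tgt e := (G.tgt e.1).attach.map fun w => ⟨w.1, G.reach_tgt e.2 w.2⟩
  length_tgt e := by simpa using G.length_tgt e.1

/-- Isomorphisms: bijections of the vertices and of the edges that preserve the root, the
sources, the targets and the labels. -/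
structure Iso (G H : SyncGraph Sg p) where
  onV : G.V ≃ H.V
  onE : G.E ≃ H.E
  root : onV G.root = H.root
  src : ∀ e, onV (G.src e) = H.src (onE e)
  lab : ∀ e, G.lab e = H.lab (onE e)
  tgt : ∀ e, (G.tgt e).map onV = H.tgt (onE e)

/-- A relation `R` is a simulation `G → H`. -/
def IsSimulation (G H : SyncGraph Sg p) (R : G.V → H.V → Prop) : Prop :=
  R G.root H.root ∧ ∀ (e : G.E) (v' : H.V), R (G.src e) v' →
    ∃ e' : H.E, H.src e' = v' ∧ H.lab e' = G.lab e ∧ List.Forall₂ R (G.tgt e) (H.tgt e')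

/-- There is a simulation `G → H`. -/
def SimLE (G H : SyncGraph Sg p) : Prop :=
  ∃ R, G.IsSimulation H R

end SyncGraph

/-- A synchronization tree `1 → p` over `Sg`: every vertex is the target of a unique path
starting at the root. -/
structure SyncTree (Sg : ℕ → Type u) (p : ℕ) extends SyncGraph Sg p where
  existsUnique_path : ∀ v, ∃! l, toSyncGraph.IsPath toSyncGraph.root l v

namespace SyncGraph

variable {Sg : ℕ → Type u} {p q r n : ℕ}

/-! ### Paths, unfolding -/

theorem isPath_append (G : SyncGraph Sg p) {v w : G.V} {l m : List (G.E × ℕ)} :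
    G.IsPath v (l ++ m) w ↔ ∃ x, G.IsPath v l x ∧ G.IsPath x m w := by
  induction l generalizing v with
  | nil => simp [IsPath]
  | cons a l ih =>
    obtain ⟨e, i⟩ := a
    simp only [List.cons_append, IsPath, ih]
    constructor
    · rintro ⟨h1, x, h2, y, h3, h4⟩
      exact ⟨y, ⟨h1, x, h2, h3⟩, h4⟩
    · rintro ⟨y, ⟨h1, x, h2, h3⟩, h4⟩
      exact ⟨h1, x, h2, y, h3, h4⟩

theorem isPath_concat (G : SyncGraph Sg p) {v w : G.V} {l : List (G.E × ℕ)} {e : G.E} {i : ℕ} :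
    G.IsPath v (l ++ [(e, i)]) w ↔ G.IsPath v l (G.src e) ∧ (G.tgt e)[i]? = some w := by
  rw [isPath_append]
  constructor
  · rintro ⟨x, h1, h2, y, h3, h4⟩
    cases h2
    cases h4
    exact ⟨h1, h3⟩
  · rintro ⟨h1, h2⟩
    exact ⟨_, h1, rfl, w, h2, rfl⟩

theorem IsPath.unique {G : SyncGraph Sg p} {v w w' : G.V} {l : List (G.E × ℕ)}
    (h : G.IsPath v l w) (h' : G.IsPath v l w') : w = w' := by
  induction l generalizing v with
  | nil => exact Eq.trans (Eq.symm h) h'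
  | cons a l ih =>
    obtain ⟨e, i⟩ := a
    obtain ⟨-, x, hx, h⟩ := h
    obtain ⟨-, y, hy, h'⟩ := h'
    rw [hx] at hy
    cases hy
    exact ih h h'

theorem IsPath.reach {G : SyncGraph Sg p} {v w : G.V} {l : List (G.E × ℕ)}
    (h : G.IsPath v l w) : G.Reach v w := by
  induction l generalizing v with
  | nil => cases h; exact Relation.ReflTransGen.refl
  | cons a l ih =>
    obtain ⟨e, i⟩ := a
    obtain ⟨he, x, hx, h⟩ := h
    exact Relation.ReflTransGen.head ⟨e, he, List.mem_of_getElem? hx⟩ (ih h)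

theorem Reach.exists_isPath {G : SyncGraph Sg p} {v w : G.V} (h : G.Reach v w) :
    ∃ l, G.IsPath v l w := by
  induction h with
  | refl => exact ⟨[], rfl⟩
  | tail _ hxy ih =>
    obtain ⟨e, rfl, hw⟩ := hxy
    obtain ⟨l, hl⟩ := ih
    obtain ⟨i, hi⟩ := List.mem_iff_getElem?.1 hw
    exact ⟨l ++ [(e, i)], (isPath_concat G).2 ⟨hl, hi⟩⟩

/-- A local criterion for a hyper graph to be a tree. -/
theorem existsUnique_path_of_local (G : SyncGraph Sg p)
    (h0 : ∀ e, G.root ∉ G.tgt e)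
    (h1 : ∀ (e e' : G.E) (i i' : ℕ) (w : G.V), (G.tgt e)[i]? = some w → (G.tgt e')[i']? = some w → e = e' ∧ i = i')
    (h2 : ∀ v, ∃ l, G.IsPath G.root l v) (v : G.V) : ∃! l, G.IsPath G.root l v := by
  obtain ⟨l, hl⟩ := h2 v
  refine ⟨l, hl, fun l' hl' => ?_⟩
  induction l using List.reverseRecOn generalizing v l' with
  | nil =>
    cases hl
    rcases List.eq_nil_or_concat' l' with rfl | ⟨m, ⟨e, i⟩, rfl⟩
    · rfl
    · exact absurd (List.mem_of_getElem? ((isPath_concat G).1 hl').2) (h0 e)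
  | append_singleton m a ih =>
    obtain ⟨e, i⟩ := a
    obtain ⟨hm, hi⟩ := (isPath_concat G).1 hl
    rcases List.eq_nil_or_concat' l' with rfl | ⟨m', ⟨e', i'⟩, rfl⟩
    · cases hl'
      exact absurd (List.mem_of_getElem? hi) (h0 e)
    · obtain ⟨hm', hi'⟩ := (isPath_concat G).1 hl'
      obtain ⟨rfl, rfl⟩ := h1 _ _ _ _ _ hi hi'
      rw [ih _ hm _ hm']

/-- The hyper graph underlying the unfolding of `G`: its vertices are the paths of `G` that
start at the root, and every edge of `G` gives an edge at each path that ends in its source. -/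
def unfoldGraph (G : SyncGraph Sg p) : SyncGraph Sg p where
  V := {l : List (G.E × ℕ) // ∃ w, G.IsPath G.root l w}
  E := {a : List (G.E × ℕ) × G.E // G.IsPath G.root a.1 (G.src a.2)}
  countable_V := have := G.countable_E; inferInstance
  countable_E := have := G.countable_E; inferInstance
  root := ⟨[], G.root, rfl⟩
  src a := ⟨a.1.1, _, a.2⟩
  lab a := G.lab a.1.2
  tgt a := List.ofFn fun i : Fin (G.tgt a.1.2).length =>
    ⟨a.1.1 ++ [(a.1.2, (i : ℕ))], (G.tgt a.1.2)[i],
      (isPath_concat G).2 ⟨a.2, List.getElem?_eq_getElem i.2⟩⟩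
  length_tgt a := by simpa using G.length_tgt a.1.2

theorem unfoldGraph_getElem? (G : SyncGraph Sg p) (a : G.unfoldGraph.E) (i : ℕ)
    (x : G.unfoldGraph.V) : (G.unfoldGraph.tgt a)[i]? = some x ↔ x.1 = a.1.1 ++ [(a.1.2, i)] := by
  have key : (G.unfoldGraph.tgt a)[i]? = if h : i < (G.tgt a.1.2).length then
      some (⟨a.1.1 ++ [(a.1.2, i)], (G.tgt a.1.2)[i],
        (isPath_concat G).2 ⟨a.2, List.getElem?_eq_getElem h⟩⟩ : G.unfoldGraph.V) else none :=
    List.getElem?_ofFn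
  rw [key]
  constructor
  · intro h
    split_ifs at h with hi
    cases h
    rfl
  · intro h
    obtain ⟨w, hw⟩ := x.2
    rw [h, isPath_concat] at hw
    have hi : i < (G.tgt a.1.2).length := (List.getElem?_eq_some_iff.1 hw.2).1
    rw [dif_pos hi]
    refine congrArg some (Subtype.ext ?_)
    exact h.symm

theorem unfoldGraph_path (G : SyncGraph Sg p) (l : List (G.E × ℕ)) (w : G.V)
    (h : G.IsPath G.root l w) :
    ∃ m, G.unfoldGraph.IsPath G.unfoldGraph.root m ⟨l, w, h⟩ := by
  induction l using List.reverseRecOn generalizing w with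
  | nil => exact ⟨[], rfl⟩
  | append_singleton m a ih =>
    obtain ⟨e, i⟩ := a
    have h' := (isPath_concat G).1 h
    obtain ⟨k, hk⟩ := ih _ h'.1
    let b : G.unfoldGraph.E := ⟨(m, e), h'.1⟩
    exact ⟨k ++ [(b, i)],
      (isPath_concat _).2 ⟨hk, (unfoldGraph_getElem? G b _ _).2 rfl⟩⟩

/-- The unfolding of `G` into a synchronization tree. It replaces shared parts of `G` by
disjoint copies and drops the vertices that are not accessible from the root. -/
def unfold (G : SyncGraph Sg p) : SyncTree Sg p where
  toSyncGraph := G.unfoldGraph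
  existsUnique_path := by
    refine existsUnique_path_of_local _ ?_ ?_ ?_
    · intro a ha
      obtain ⟨i, hi⟩ := List.mem_iff_getElem?.1 ha
      have := (unfoldGraph_getElem? G _ _ _).1 hi
      simp [unfoldGraph] at this
    · intro a a' i i' x h h'
      have h1 := (unfoldGraph_getElem? G _ _ _).1 h
      have h2 := (unfoldGraph_getElem? G _ _ _).1 h'
      rw [h1] at h2
      obtain ⟨h3, h4⟩ := List.append_inj' h2 rfl
      simp only [List.cons.injEq, Prod.mk.injEq, and_true] at h4
      exact ⟨Subtype.ext (Prod.ext h3 h4.1), h4.2⟩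
    · rintro ⟨l, w, h⟩
      exact unfoldGraph_path G l w h

/-! ### Simulations -/

/-- `G.Step v a ws`: there is an edge `v → ws` labeled `a`. -/
def Step (G : SyncGraph Sg p) (v : G.V) (a : Label Sg p) (ws : List G.V) : Prop :=
  ∃ e, G.src e = v ∧ G.lab e = a ∧ G.tgt e = ws

/-- The local condition of a simulation. -/
def LocalSim (G H : SyncGraph Sg p) (R : G.V → H.V → Prop) : Prop :=
  ∀ v v', R v v' → ∀ a ws, G.Step v a ws → ∃ ws', H.Step v' a ws' ∧ List.Forall₂ R ws ws'

/-- The greatest relation that satisfies the local condition of a simulation. -/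
def Sim (G H : SyncGraph Sg p) (v : G.V) (w : H.V) : Prop :=
  ∃ R, LocalSim G H R ∧ R v w

theorem localSim_iff {G H : SyncGraph Sg p} {R : G.V → H.V → Prop} :
    LocalSim G H R ↔ ∀ (e : G.E) (v' : H.V), R (G.src e) v' →
      ∃ e' : H.E, H.src e' = v' ∧ H.lab e' = G.lab e ∧ List.Forall₂ R (G.tgt e) (H.tgt e') := by
  constructor
  · intro h e v' hv
    obtain ⟨_, ⟨e', h1, h2, rfl⟩, h3⟩ := h _ _ hv _ _ ⟨e, rfl, rfl, rfl⟩
    exact ⟨e', h1, h2, h3⟩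
  · rintro h _ v' hv _ _ ⟨e, rfl, rfl, rfl⟩
    obtain ⟨e', h1, h2, h3⟩ := h e v' hv
    exact ⟨_, ⟨e', h1, h2, rfl⟩, h3⟩

theorem simLE_iff {G H : SyncGraph Sg p} : G.SimLE H ↔ Sim G H G.root H.root := by
  constructor
  · rintro ⟨R, h0, h1⟩
    exact ⟨R, localSim_iff.2 h1, h0⟩
  · rintro ⟨R, h1, h0⟩
    exact ⟨R, h0, localSim_iff.1 h1⟩

theorem localSim_sim (G H : SyncGraph Sg p) : LocalSim G H (Sim G H) := by
  rintro v v' ⟨R, hR, hv⟩ a ws hs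
  obtain ⟨ws', h1, h2⟩ := hR v v' hv a ws hs
  exact ⟨ws', h1, h2.imp fun x y h => ⟨R, hR, h⟩⟩

theorem sim_of_step {G H : SyncGraph Sg p} {v : G.V} {w : H.V}
    (h : ∀ a us, G.Step v a us → ∃ us', H.Step w a us' ∧ List.Forall₂ (Sim G H) us us') :
    Sim G H v w := by
  refine ⟨fun x y => Sim G H x y ∨ (x = v ∧ y = w), ?_, Or.inr ⟨rfl, rfl⟩⟩
  rintro x y (hxy | ⟨rfl, rfl⟩) a us hs
  · obtain ⟨us', h1, h2⟩ := localSim_sim G H x y hxy a us hs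
    exact ⟨us', h1, h2.imp fun _ _ => Or.inl⟩
  · obtain ⟨us', h1, h2⟩ := h a us hs
    exact ⟨us', h1, h2.imp fun _ _ => Or.inl⟩

theorem sim_refl (G : SyncGraph Sg p) (v : G.V) : Sim G G v v := by
  refine ⟨Eq, ?_, rfl⟩
  rintro v _ rfl a ws hs
  exact ⟨ws, hs, List.forall₂_same.2 fun _ _ => rfl⟩

theorem forall₂_trans {α β γ : Type*} {R : α → β → Prop} {S : β → γ → Prop} {Q : α → γ → Prop}
    (hQ : ∀ a b c, R a b → S b c → Q a c) {l : List α} {m : List β} {k : List γ}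
    (h : List.Forall₂ R l m) (h' : List.Forall₂ S m k) : List.Forall₂ Q l k := by
  induction h generalizing k with
  | nil => cases h'; exact List.Forall₂.nil
  | cons h _ ih =>
    cases h' with
    | cons h1 h2 => exact List.Forall₂.cons (hQ _ _ _ h h1) (ih h2)

theorem Sim.trans {G H K : SyncGraph Sg p} {x : G.V} {y : H.V} {z : K.V}
    (h : Sim G H x y) (h' : Sim H K y z) : Sim G K x z := by
  refine ⟨fun x z => ∃ y, Sim G H x y ∧ Sim H K y z, ?_, y, h, h'⟩
  rintro x z ⟨y, h, h'⟩ a ws hs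
  obtain ⟨ws', h1, h2⟩ := localSim_sim G H x y h a ws hs
  obtain ⟨ws'', h3, h4⟩ := localSim_sim H K y z h' a ws' h1
  exact ⟨ws'', h3, forall₂_trans (fun a b c h h' => ⟨b, h, h'⟩) h2 h4⟩

theorem SimLE.refl (G : SyncGraph Sg p) : G.SimLE G :=
  simLE_iff.2 (sim_refl G _)

theorem SimLE.trans {G H K : SyncGraph Sg p} (h : G.SimLE H) (h' : H.SimLE K) : G.SimLE K :=
  simLE_iff.2 ((simLE_iff.1 h).trans (simLE_iff.1 h'))

theorem forall₂_unfold {G : SyncGraph Sg p} (a : G.unfoldGraph.E) :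
    List.Forall₂ (fun (x : G.unfoldGraph.V) w => G.IsPath G.root x.1 w)
      (G.unfoldGraph.tgt a) (G.tgt a.1.2) := by
  refine List.forall₂_iff_get.2 ⟨by simp [unfoldGraph], fun i h1 h2 => ?_⟩
  have h3 := (unfoldGraph_getElem? G a i _).1 (List.getElem?_eq_getElem h1)
  simp only [List.get_eq_getElem]
  rw [h3]
  exact (isPath_concat G).2 ⟨a.2, List.getElem?_eq_getElem h2⟩

theorem unfold_simLE (G : SyncGraph Sg p) : G.unfold.SimLE G := by
  refine ⟨fun x w => G.IsPath G.root x.1 w, rfl, fun a w h => ?_⟩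
  exact ⟨a.1.2, IsPath.unique a.2 h, rfl, forall₂_unfold a⟩

theorem simLE_unfold (G : SyncGraph Sg p) : G.SimLE G.unfold.toSyncGraph := by
  refine ⟨fun w x => G.IsPath G.root x.1 w, rfl, fun e x h => ?_⟩
  exact ⟨⟨(x.1, e), h⟩, rfl, rfl, (forall₂_unfold (G := G) ⟨(x.1, e), h⟩).flip⟩

/-! ### The operations on synchronization trees -/

/-- The tree without edges. -/
def zeroGraph (Sg : ℕ → Type u) (p : ℕ) : SyncGraph Sg p where
  V := Unit
  E := Empty
  countable_V := inferInstance
  countable_E := inferInstance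
  root := ()
  src e := e.elim
  lab e := e.elim
  tgt e := e.elim
  length_tgt e := e.elim

/-- The tree with a single edge, which is labeled `ex_i`. -/
def exitGraph (Sg : ℕ → Type u) {p : ℕ} (i : Fin p) : SyncGraph Sg p where
  V := Unit
  E := Unit
  countable_V := inferInstance
  countable_E := inferInstance
  root := ()
  src _ := ()
  lab _ := .exit i
  tgt _ := []
  length_tgt _ := rfl

/-- The tree `1 → n` of a letter `σ` of rank `n`: an edge from the root (the vertex `none`)
to `n` vertices labeled `σ`, and an edge labeled `ex_i` at the `i`-th of them. -/
def letterGraph {n : ℕ} (σ : Sg n) : SyncGraph Sg n where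
  V := Option (Fin n)
  E := Option (Fin n)
  countable_V := inferInstance
  countable_E := inferInstance
  root := none
  src e := e
  lab e := match e with
    | none => .letter ⟨n, σ⟩
    | some i => .exit i
  tgt e := match e with
    | none => (List.finRange n).map some
    | some _ => []
  length_tgt e := by cases e <;> simp [Label.rank]

/-- `G` and `H` with a new root (the vertex `none`) at which the edges of both roots start. -/
def sumGraph (G H : SyncGraph Sg p) : SyncGraph Sg p where
  V := Option (G.V ⊕ H.V)
  E := (G.E ⊕ H.E) ⊕ ({e : G.E // G.src e = G.root} ⊕ {e : H.E // H.src e = H.root})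
  countable_V := have := G.countable_V; have := H.countable_V; inferInstance
  countable_E := have := G.countable_E; have := H.countable_E; inferInstance
  root := none
  src e := match e with
    | .inl (.inl e) => some (.inl (G.src e))
    | .inl (.inr e) => some (.inr (H.src e))
    | .inr _ => none
  lab e := match e with
    | .inl (.inl e) => G.lab e
    | .inl (.inr e) => H.lab e
    | .inr (.inl e) => G.lab e.1
    | .inr (.inr e) => H.lab e.1
  tgt e := match e with
    | .inl (.inl e) => (G.tgt e).map fun v => some (.inl v)
    | .inl (.inr e) => (H.tgt e).map fun v => some (.inr v)
    | .inr (.inl e) => (G.tgt e.1).map fun v => some (.inl v)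
    | .inr (.inr e) => (H.tgt e.1).map fun v => some (.inr v)
  length_tgt e := by
    rcases e with (e | e) | (e | e) <;> simp [SyncGraph.length_tgt]

/-- `G` together with `H_1, …, H_p`, where each edge of `G` labeled `ex_i` is replaced by the
edges at the root of `H_i`. -/
def compGraph (G : SyncGraph Sg p) (H : Fin p → SyncGraph Sg q) : SyncGraph Sg q where
  V := G.V ⊕ Σ i, (H i).V
  E := {e : G.E // ∀ i, G.lab e ≠ .exit i} ⊕
    ((Σ i : Fin p, {e : G.E // G.lab e = .exit i} × {e : (H i).E // (H i).src e = (H i).root}) ⊕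
      Σ i : Fin p, (H i).E)
  countable_V := by
    have := G.countable_V
    have := fun i => (H i).countable_V
    infer_instance
  countable_E := by
    have := G.countable_E
    have := fun i => (H i).countable_E
    infer_instance
  root := .inl G.root
  src e := match e with
    | .inl x => .inl (G.src x.1)
    | .inr (.inl x) => .inl (G.src x.2.1.1)
    | .inr (.inr x) => .inr ⟨x.1, (H x.1).src x.2⟩
  lab e := match e with
    | .inl x => .letter ((G.lab x.1).getLetter x.2)
    | .inr (.inl x) => (H x.1).lab x.2.2.1
    | .inr (.inr x) => (H x.1).lab x.2
  tgt e := match e with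
    | .inl x => (G.tgt x.1).map .inl
    | .inr (.inl x) => ((H x.1).tgt x.2.2.1).map fun v => .inr ⟨x.1, v⟩
    | .inr (.inr x) => ((H x.1).tgt x.2).map fun v => .inr ⟨x.1, v⟩
  length_tgt e := by
    rcases e with x | (x | x)
    · have h := G.length_tgt x.1
      rw [← Label.letter_getLetter _ x.2] at h
      simpa [Label.rank] using h
    · simp [SyncGraph.length_tgt]
    · simp [SyncGraph.length_tgt]

/-! ### Steps of the constructed graphs, and the laws of composition and sum -/

theorem Step.length {G : SyncGraph Sg p} {v : G.V} {a : Label Sg p} {ws : List G.V}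
    (h : G.Step v a ws) : ws.length = a.rank := by
  obtain ⟨e, -, rfl, rfl⟩ := h
  exact G.length_tgt e

theorem Step.exit_nil {G : SyncGraph Sg p} {v : G.V} {i : Fin p} {ws : List G.V}
    (h : G.Step v (.exit i) ws) : ws = [] :=
  List.length_eq_zero_iff.1 h.length

theorem zero_step {v : (zeroGraph Sg p).V} {a : Label Sg p} {ws : List (zeroGraph Sg p).V} :
    ¬ (zeroGraph Sg p).Step v a ws := by
  rintro ⟨e, -⟩
  exact e.elim

theorem exit_step {i : Fin p} {v : (exitGraph Sg i).V} {a : Label Sg p}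
    {ws : List (exitGraph Sg i).V} :
    (exitGraph Sg i).Step v a ws ↔ a = .exit i ∧ ws = [] := by
  constructor
  · rintro ⟨e, -, rfl, rfl⟩
    exact ⟨rfl, rfl⟩
  · rintro ⟨rfl, rfl⟩
    exact ⟨(), rfl, rfl, rfl⟩

/-- A vertex of `G` in `sumGraph G H`. -/
abbrev sumL (G H : SyncGraph Sg p) (v : G.V) : (sumGraph G H).V := some (.inl v)

/-- A vertex of `H` in `sumGraph G H`. -/
abbrev sumR (G H : SyncGraph Sg p) (v : H.V) : (sumGraph G H).V := some (.inr v)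

/-- A vertex of `G` in `compGraph G H`. -/
abbrev compL (G : SyncGraph Sg p) (H : Fin p → SyncGraph Sg q) (v : G.V) : (compGraph G H).V :=
  .inl v

/-- A vertex of `H i` in `compGraph G H`. -/
abbrev compR (G : SyncGraph Sg p) (H : Fin p → SyncGraph Sg q) (i : Fin p) (v : (H i).V) :
    (compGraph G H).V :=
  .inr ⟨i, v⟩

theorem sum_step_none {G H : SyncGraph Sg p} {a : Label Sg p} {ws : List (sumGraph G H).V} :
    (sumGraph G H).Step (sumGraph G H).root a ws ↔
      (∃ us, G.Step G.root a us ∧ ws = us.map (sumL G H)) ∨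
      ∃ us, H.Step H.root a us ∧ ws = us.map (sumR G H) := by
  constructor
  · rintro ⟨(e | e) | (e | e), h, rfl, rfl⟩
    · cases h
    · cases h
    · exact Or.inl ⟨_, ⟨e.1, e.2, rfl, rfl⟩, rfl⟩
    · exact Or.inr ⟨_, ⟨e.1, e.2, rfl, rfl⟩, rfl⟩
  · rintro (⟨_, ⟨e, h, rfl, rfl⟩, rfl⟩ | ⟨_, ⟨e, h, rfl, rfl⟩, rfl⟩)
    · exact ⟨.inr (.inl ⟨e, h⟩), rfl, rfl, rfl⟩
    · exact ⟨.inr (.inr ⟨e, h⟩), rfl, rfl, rfl⟩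

theorem sum_step_inl {G H : SyncGraph Sg p} {v : G.V} {a : Label Sg p}
    {ws : List (sumGraph G H).V} :
    (sumGraph G H).Step (sumL G H v) a ws ↔
      ∃ us, G.Step v a us ∧ ws = us.map (sumL G H) := by
  constructor
  · rintro ⟨(e | e) | (e | e), h, rfl, rfl⟩ <;> cases h
    exact ⟨_, ⟨e, rfl, rfl, rfl⟩, rfl⟩
  · rintro ⟨_, ⟨e, rfl, rfl, rfl⟩, rfl⟩
    exact ⟨.inl (.inl e), rfl, rfl, rfl⟩

theorem sum_step_inr {G H : SyncGraph Sg p} {v : H.V} {a : Label Sg p}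
    {ws : List (sumGraph G H).V} :
    (sumGraph G H).Step (sumR G H v) a ws ↔
      ∃ us, H.Step v a us ∧ ws = us.map (sumR G H) := by
  constructor
  · rintro ⟨(e | e) | (e | e), h, rfl, rfl⟩ <;> cases h
    exact ⟨_, ⟨e, rfl, rfl, rfl⟩, rfl⟩
  · rintro ⟨_, ⟨e, rfl, rfl, rfl⟩, rfl⟩
    exact ⟨.inl (.inr e), rfl, rfl, rfl⟩

theorem comp_step_inl {G : SyncGraph Sg p} {H : Fin p → SyncGraph Sg q} {v : G.V}
    {a : Label Sg q} {ws : List (compGraph G H).V} :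
    (compGraph G H).Step (compL G H v) a ws ↔
      (∃ σ us, G.Step v (.letter σ) us ∧ a = .letter σ ∧ ws = us.map (compL G H)) ∨
      ∃ i us, G.Step v (.exit i) [] ∧ (H i).Step (H i).root a us ∧
        ws = us.map (compR G H i) := by
  constructor
  · rintro ⟨x | (x | x), h, rfl, rfl⟩ <;> cases h
    · exact Or.inl ⟨_, _, ⟨x.1, rfl, (Label.letter_getLetter _ x.2).symm, rfl⟩, rfl, rfl⟩
    · have h : G.Step (G.src x.2.1.1) (.exit x.1) (G.tgt x.2.1.1) := ⟨_, rfl, x.2.1.2, rfl⟩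
      rw [h.exit_nil] at h
      exact Or.inr ⟨x.1, _, h, ⟨_, x.2.2.2, rfl, rfl⟩, rfl⟩
  · rintro (⟨σ, _, ⟨e, rfl, h, rfl⟩, rfl, rfl⟩ | ⟨i, _, ⟨e, rfl, h, -⟩, ⟨e', h', rfl, rfl⟩, rfl⟩)
    · have he : ∀ i, G.lab e ≠ .exit i := by
        intro i hi
        rw [h] at hi
        cases hi
      exact ⟨.inl ⟨e, he⟩, rfl,
        congrArg Label.letter (Label.letter.inj ((Label.letter_getLetter _ he).trans h)), rfl⟩
    · exact ⟨.inr (.inl ⟨i, ⟨e, h⟩, ⟨e', h'⟩⟩), rfl, rfl, rfl⟩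

theorem comp_step_inr {G : SyncGraph Sg p} {H : Fin p → SyncGraph Sg q} {i : Fin p} {v : (H i).V}
    {a : Label Sg q} {ws : List (compGraph G H).V} :
    (compGraph G H).Step (compR G H i v) a ws ↔
      ∃ us, (H i).Step v a us ∧ ws = us.map (compR G H i) := by
  constructor
  · rintro ⟨x | (x | x), h, rfl, rfl⟩ <;> cases h
    exact ⟨_, ⟨x.2, rfl, rfl, rfl⟩, rfl⟩
  · rintro ⟨_, ⟨e, rfl, rfl, rfl⟩, rfl⟩
    exact ⟨.inr (.inr ⟨i, e⟩), rfl, rfl, rfl⟩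

theorem forall₂_map_right {α β : Type*} {R : α → β → Prop} {f : α → β} (h : ∀ a, R a (f a))
    (l : List α) : List.Forall₂ R l (l.map f) :=
  List.forall₂_map_right_iff.2 (List.forall₂_same.2 fun a _ => h a)

theorem forall₂_map_left {α β : Type*} {R : β → α → Prop} {f : α → β} (h : ∀ a, R (f a) a)
    (l : List α) : List.Forall₂ R (l.map f) l :=
  List.forall₂_map_left_iff.2 (List.forall₂_same.2 fun a _ => h a)

theorem forall₂_map_both {α β γ δ : Type*} {R : α → β → Prop} {S : γ → δ → Prop} {f : α → γ}
    {g : β → δ} (h : ∀ a b, R a b → S (f a) (g b)) {l : List α} {m : List β}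
    (hl : List.Forall₂ R l m) : List.Forall₂ S (l.map f) (m.map g) :=
  List.forall₂_map_left_iff.2 (List.forall₂_map_right_iff.2 (hl.imp h))

theorem sim_comp_inr (G : SyncGraph Sg p) (H : Fin p → SyncGraph Sg q) (i : Fin p) (v : (H i).V) :
    Sim (H i) (compGraph G H) v (compR G H i v) := by
  refine ⟨fun v x => x = compR G H i v, ?_, rfl⟩
  rintro v _ rfl a ws hs
  exact ⟨_, comp_step_inr.2 ⟨ws, hs, rfl⟩, forall₂_map_right (by intro _; exact rfl) _⟩

theorem comp_inr_sim (G : SyncGraph Sg p) (H : Fin p → SyncGraph Sg q) (i : Fin p) (v : (H i).V) :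
    Sim (compGraph G H) (H i) (compR G H i v) v := by
  refine ⟨fun x v => x = compR G H i v, ?_, rfl⟩
  rintro _ v rfl a ws hs
  obtain ⟨us, h, rfl⟩ := comp_step_inr.1 hs
  exact ⟨us, h, forall₂_map_left (by intro _; exact rfl) _⟩

theorem comp_mono {G G' : SyncGraph Sg p} {H H' : Fin p → SyncGraph Sg q} (hG : G.SimLE G')
    (hH : ∀ i, (H i).SimLE (H' i)) : (compGraph G H).SimLE (compGraph G' H') := by
  refine simLE_iff.2 ⟨fun x y => (∃ v v', x = compL G H v ∧ y = compL G' H' v' ∧ Sim G G' v v') ∨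
    (∃ i w w', x = compR G H i w ∧ y = compR G' H' i w' ∧ Sim (H i) (H' i) w w'), ?_,
    Or.inl ⟨_, _, rfl, rfl, simLE_iff.1 hG⟩⟩
  rintro _ _ (⟨v, v', rfl, rfl, hv⟩ | ⟨i, w, w', rfl, rfl, hw⟩) a ws hs
  · obtain ⟨σ, us, h1, rfl, rfl⟩ | ⟨i, us, h1, h2, rfl⟩ := comp_step_inl.1 hs
    · obtain ⟨us', h3, h4⟩ := localSim_sim _ _ _ _ hv _ _ h1
      exact ⟨_, comp_step_inl.2 (Or.inl ⟨σ, us', h3, rfl, rfl⟩),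
        forall₂_map_both (by intro x y h; exact Or.inl ⟨x, y, rfl, rfl, h⟩) h4⟩
    · obtain ⟨us', h3, h4⟩ := localSim_sim _ _ _ _ hv _ _ h1
      cases h4
      obtain ⟨us', h5, h6⟩ := localSim_sim _ _ _ _ (simLE_iff.1 (hH i)) _ _ h2
      exact ⟨_, comp_step_inl.2 (Or.inr ⟨i, us', h3, h5, rfl⟩),
        forall₂_map_both (by intro x y h; exact Or.inr ⟨i, x, y, rfl, rfl, h⟩) h6⟩
  · obtain ⟨us, h1, rfl⟩ := comp_step_inr.1 hs
    obtain ⟨us', h3, h4⟩ := localSim_sim _ _ _ _ hw _ _ h1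
    exact ⟨_, comp_step_inr.2 ⟨us', h3, rfl⟩,
        forall₂_map_both (by intro x y h; exact Or.inr ⟨i, x, y, rfl, rfl, h⟩) h4⟩

theorem comp_assoc_le (G : SyncGraph Sg p) (H : Fin p → SyncGraph Sg q)
    (K : Fin q → SyncGraph Sg r) :
    (compGraph (compGraph G H) K).SimLE (compGraph G fun i => compGraph (H i) K) := by
  refine simLE_iff.2 ⟨fun x y => (∃ v, x = compL (compGraph G H) K (compL G H v) ∧
      y = compL G (fun i => compGraph (H i) K) v) ∨
    (∃ i w, x = compL (compGraph G H) K (compR G H i w) ∧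
      y = compR G (fun i => compGraph (H i) K) i (compL (H i) K w)) ∨
    (∃ i j z, x = compR (compGraph G H) K j z ∧
      y = compR G (fun i => compGraph (H i) K) i (compR (H i) K j z)), ?_, Or.inl ⟨_, rfl, rfl⟩⟩
  rintro _ _ (⟨v, rfl, rfl⟩ | ⟨i, w, rfl, rfl⟩ | ⟨i, j, z, rfl, rfl⟩) a ws hs
  · obtain ⟨σ, us, h1, rfl, rfl⟩ | ⟨j, us, h1, h2, rfl⟩ := comp_step_inl.1 hs
    · obtain ⟨σ', us', h3, h4, rfl⟩ | ⟨i, us', h3, h4, rfl⟩ := comp_step_inl.1 h1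
      · cases h4
        exact ⟨_, comp_step_inl.2 (Or.inl ⟨σ, us', h3, rfl, rfl⟩), by
          rw [List.forall₂_map_left_iff, List.forall₂_map_left_iff, List.forall₂_map_right_iff]
          exact List.forall₂_same.2 fun w _ => Or.inl ⟨w, rfl, rfl⟩⟩
      · refine ⟨_, comp_step_inl.2 (Or.inr ⟨i, _, h3,
          comp_step_inl.2 (Or.inl ⟨σ, us', h4, rfl, rfl⟩), rfl⟩), ?_⟩
        rw [List.forall₂_map_left_iff, List.forall₂_map_left_iff, List.forall₂_map_right_iff,
          List.forall₂_map_right_iff]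
        exact List.forall₂_same.2 fun w _ => Or.inr (Or.inl ⟨i, w, rfl, rfl⟩)
    · obtain ⟨σ', us', h3, h4, h5⟩ | ⟨i, us', h3, h4, h5⟩ := comp_step_inl.1 h1
      · cases h4
      · obtain rfl := List.map_eq_nil_iff.1 h5.symm
        refine ⟨_, comp_step_inl.2 (Or.inr ⟨i, _, h3,
          comp_step_inl.2 (Or.inr ⟨j, us, h4, h2, rfl⟩), rfl⟩), ?_⟩
        rw [List.forall₂_map_left_iff, List.forall₂_map_right_iff, List.forall₂_map_right_iff]
        exact List.forall₂_same.2 fun w _ => Or.inr (Or.inr ⟨i, j, w, rfl, rfl⟩)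
  · obtain ⟨σ, us, h1, rfl, rfl⟩ | ⟨j, us, h1, h2, rfl⟩ := comp_step_inl.1 hs
    · obtain ⟨us', h3, rfl⟩ := comp_step_inr.1 h1
      refine ⟨_, comp_step_inr.2 ⟨_, comp_step_inl.2 (Or.inl ⟨σ, us', h3, rfl, rfl⟩), rfl⟩, ?_⟩
      rw [List.forall₂_map_left_iff, List.forall₂_map_left_iff, List.forall₂_map_right_iff,
        List.forall₂_map_right_iff]
      exact List.forall₂_same.2 fun w _ => Or.inr (Or.inl ⟨i, w, rfl, rfl⟩)
    · obtain ⟨us', h3, h5⟩ := comp_step_inr.1 h1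
      obtain rfl := List.map_eq_nil_iff.1 h5.symm
      refine ⟨_, comp_step_inr.2 ⟨_, comp_step_inl.2 (Or.inr ⟨j, us, h3, h2, rfl⟩), rfl⟩, ?_⟩
      rw [List.forall₂_map_left_iff, List.forall₂_map_right_iff, List.forall₂_map_right_iff]
      exact List.forall₂_same.2 fun w _ => Or.inr (Or.inr ⟨i, j, w, rfl, rfl⟩)
  · obtain ⟨us, h1, rfl⟩ := comp_step_inr.1 hs
    refine ⟨_, comp_step_inr.2 ⟨_, comp_step_inr.2 ⟨us, h1, rfl⟩, rfl⟩, ?_⟩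
    rw [List.forall₂_map_left_iff, List.forall₂_map_right_iff, List.forall₂_map_right_iff]
    exact List.forall₂_same.2 fun w _ => Or.inr (Or.inr ⟨i, j, w, rfl, rfl⟩)

theorem le_comp_assoc (G : SyncGraph Sg p) (H : Fin p → SyncGraph Sg q)
    (K : Fin q → SyncGraph Sg r) :
    (compGraph G fun i => compGraph (H i) K).SimLE (compGraph (compGraph G H) K) := by
  refine simLE_iff.2 ⟨fun y x => (∃ v, x = compL (compGraph G H) K (compL G H v) ∧
      y = compL G (fun i => compGraph (H i) K) v) ∨
    (∃ i w, x = compL (compGraph G H) K (compR G H i w) ∧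
      y = compR G (fun i => compGraph (H i) K) i (compL (H i) K w)) ∨
    (∃ i j z, x = compR (compGraph G H) K j z ∧
      y = compR G (fun i => compGraph (H i) K) i (compR (H i) K j z)), ?_, Or.inl ⟨_, rfl, rfl⟩⟩
  rintro _ _ (⟨v, rfl, rfl⟩ | ⟨i, w, rfl, rfl⟩ | ⟨i, j, z, rfl, rfl⟩) a ws hs
  · obtain ⟨σ, us, h1, rfl, rfl⟩ | ⟨i, us, h1, h2, rfl⟩ := comp_step_inl.1 hs
    · refine ⟨_, comp_step_inl.2 (Or.inl ⟨σ, _,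
        comp_step_inl.2 (Or.inl ⟨σ, us, h1, rfl, rfl⟩), rfl, rfl⟩), ?_⟩
      rw [List.forall₂_map_left_iff, List.forall₂_map_right_iff, List.forall₂_map_right_iff]
      exact List.forall₂_same.2 fun w _ => Or.inl ⟨w, rfl, rfl⟩
    · obtain ⟨σ, us', h3, rfl, rfl⟩ | ⟨j, us', h3, h4, rfl⟩ := comp_step_inl.1 h2
      · refine ⟨_, comp_step_inl.2 (Or.inl ⟨σ, _,
          comp_step_inl.2 (Or.inr ⟨i, us', h1, h3, rfl⟩), rfl, rfl⟩), ?_⟩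
        rw [List.forall₂_map_left_iff, List.forall₂_map_left_iff, List.forall₂_map_right_iff,
          List.forall₂_map_right_iff]
        exact List.forall₂_same.2 fun w _ => Or.inr (Or.inl ⟨i, w, rfl, rfl⟩)
      · refine ⟨_, comp_step_inl.2 (Or.inr ⟨j, us',
          comp_step_inl.2 (Or.inr ⟨i, _, h1, h3, rfl⟩), h4, rfl⟩), ?_⟩
        rw [List.forall₂_map_left_iff, List.forall₂_map_left_iff, List.forall₂_map_right_iff]
        exact List.forall₂_same.2 fun w _ => Or.inr (Or.inr ⟨i, j, w, rfl, rfl⟩)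
  · obtain ⟨us, h2, rfl⟩ := comp_step_inr.1 hs
    obtain ⟨σ, us', h3, rfl, rfl⟩ | ⟨j, us', h3, h4, rfl⟩ := comp_step_inl.1 h2
    · refine ⟨_, comp_step_inl.2 (Or.inl ⟨σ, _,
        comp_step_inr.2 ⟨us', h3, rfl⟩, rfl, rfl⟩), ?_⟩
      rw [List.forall₂_map_left_iff, List.forall₂_map_left_iff, List.forall₂_map_right_iff,
        List.forall₂_map_right_iff]
      exact List.forall₂_same.2 fun w _ => Or.inr (Or.inl ⟨i, w, rfl, rfl⟩)
    · refine ⟨_, comp_step_inl.2 (Or.inr ⟨j, us',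
        comp_step_inr.2 ⟨_, h3, rfl⟩, h4, rfl⟩), ?_⟩
      rw [List.forall₂_map_left_iff, List.forall₂_map_left_iff, List.forall₂_map_right_iff]
      exact List.forall₂_same.2 fun w _ => Or.inr (Or.inr ⟨i, j, w, rfl, rfl⟩)
  · obtain ⟨us, h2, rfl⟩ := comp_step_inr.1 hs
    obtain ⟨us', h3, rfl⟩ := comp_step_inr.1 h2
    refine ⟨_, comp_step_inr.2 ⟨us', h3, rfl⟩, ?_⟩
    rw [List.forall₂_map_left_iff, List.forall₂_map_left_iff, List.forall₂_map_right_iff]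
    exact List.forall₂_same.2 fun w _ => Or.inr (Or.inr ⟨i, j, w, rfl, rfl⟩)

theorem comp_exit_le (G : SyncGraph Sg p) : (compGraph G fun i => exitGraph Sg i).SimLE G := by
  refine simLE_iff.2 ⟨fun x v => x = compL G (fun i => exitGraph Sg i) v ∨
    ∃ i, x = compR G (fun i => exitGraph Sg i) i () ∧ G.Step v (.exit i) [], ?_,
    Or.inl rfl⟩
  rintro _ v (rfl | ⟨i, rfl, h⟩) a ws hs
  · obtain ⟨σ, us, h1, rfl, rfl⟩ | ⟨i, us, h1, h2, rfl⟩ := comp_step_inl.1 hs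
    · exact ⟨us, h1, forall₂_map_left (by intro _; exact Or.inl rfl) _⟩
    · obtain ⟨rfl, rfl⟩ := exit_step.1 h2
      exact ⟨[], h1, List.Forall₂.nil⟩
  · obtain ⟨us, h2, rfl⟩ := comp_step_inr.1 hs
    obtain ⟨rfl, rfl⟩ := exit_step.1 h2
    exact ⟨[], h, List.Forall₂.nil⟩

theorem le_comp_exit (G : SyncGraph Sg p) : G.SimLE (compGraph G fun i => exitGraph Sg i) := by
  refine simLE_iff.2 ⟨fun v x => x = compL G (fun i => exitGraph Sg i) v, ?_, rfl⟩
  rintro v _ rfl a ws hs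
  cases a with
  | letter σ =>
    exact ⟨_, comp_step_inl.2 (Or.inl ⟨σ, ws, hs, rfl, rfl⟩), forall₂_map_right (by intro _; exact rfl) _⟩
  | exit i =>
    obtain rfl := hs.exit_nil
    exact ⟨_, comp_step_inl.2 (Or.inr ⟨i, [], hs, exit_step.2 ⟨rfl, rfl⟩, rfl⟩),
      List.Forall₂.nil⟩

theorem exit_comp_le (i : Fin p) (H : Fin p → SyncGraph Sg q) :
    (compGraph (exitGraph Sg i) H).SimLE (H i) := by
  refine simLE_iff.2 (sim_of_step fun a ws hs => ?_)
  obtain ⟨σ, us, h1, rfl, rfl⟩ | ⟨j, us, h1, h2, rfl⟩ := comp_step_inl.1 hs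
  · cases (exit_step.1 h1).1
  · cases (exit_step.1 h1).1
    exact ⟨us, h2, forall₂_map_left (fun v => comp_inr_sim _ _ _ v) _⟩

theorem le_exit_comp (i : Fin p) (H : Fin p → SyncGraph Sg q) :
    (H i).SimLE (compGraph (exitGraph Sg i) H) := by
  refine simLE_iff.2 (sim_of_step fun a ws hs => ?_)
  exact ⟨_, comp_step_inl.2 (Or.inr ⟨i, ws, exit_step.2 ⟨rfl, rfl⟩, hs, rfl⟩),
    forall₂_map_right (fun v => sim_comp_inr _ _ _ v) _⟩

theorem zero_le (G : SyncGraph Sg p) : (zeroGraph Sg p).SimLE G :=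
  simLE_iff.2 (sim_of_step fun _ _ hs => (zero_step hs).elim)

theorem zero_comp_le (H : Fin p → SyncGraph Sg q) :
    (compGraph (zeroGraph Sg p) H).SimLE (zeroGraph Sg q) := by
  refine simLE_iff.2 (sim_of_step fun a ws hs => ?_)
  obtain ⟨σ, us, h1, rfl, rfl⟩ | ⟨j, us, h1, h2, rfl⟩ := comp_step_inl.1 hs
  · exact (zero_step h1).elim
  · exact (zero_step h1).elim

theorem sim_sum_inl (G H : SyncGraph Sg p) (v : G.V) :
    Sim G (sumGraph G H) v (sumL G H v) := by
  refine ⟨fun v x => x = sumL G H v, ?_, rfl⟩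
  rintro v _ rfl a ws hs
  exact ⟨_, sum_step_inl.2 ⟨ws, hs, rfl⟩, forall₂_map_right (by intro _; exact rfl) _⟩

theorem sim_sum_inr (G H : SyncGraph Sg p) (v : H.V) :
    Sim H (sumGraph G H) v (sumR G H v) := by
  refine ⟨fun v x => x = sumR G H v, ?_, rfl⟩
  rintro v _ rfl a ws hs
  exact ⟨_, sum_step_inr.2 ⟨ws, hs, rfl⟩, forall₂_map_right (by intro _; exact rfl) _⟩

theorem sum_inl_sim (G H : SyncGraph Sg p) (v : G.V) :
    Sim (sumGraph G H) G (sumL G H v) v := by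
  refine ⟨fun x v => x = sumL G H v, ?_, rfl⟩
  rintro _ v rfl a ws hs
  obtain ⟨us, h, rfl⟩ := sum_step_inl.1 hs
  exact ⟨us, h, forall₂_map_left (by intro _; exact rfl) _⟩

theorem sum_inr_sim (G H : SyncGraph Sg p) (v : H.V) :
    Sim (sumGraph G H) H (sumR G H v) v := by
  refine ⟨fun x v => x = sumR G H v, ?_, rfl⟩
  rintro _ v rfl a ws hs
  obtain ⟨us, h, rfl⟩ := sum_step_inr.1 hs
  exact ⟨us, h, forall₂_map_left (by intro _; exact rfl) _⟩

theorem le_sum_left (G H : SyncGraph Sg p) : G.SimLE (sumGraph G H) :=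
  simLE_iff.2 (sim_of_step fun _ ws hs =>
    ⟨_, sum_step_none.2 (Or.inl ⟨ws, hs, rfl⟩), forall₂_map_right (sim_sum_inl G H) _⟩)

theorem le_sum_right (G H : SyncGraph Sg p) : H.SimLE (sumGraph G H) :=
  simLE_iff.2 (sim_of_step fun _ ws hs =>
    ⟨_, sum_step_none.2 (Or.inr ⟨ws, hs, rfl⟩), forall₂_map_right (sim_sum_inr G H) _⟩)

theorem sum_le {G H K : SyncGraph Sg p} (hG : G.SimLE K) (hH : H.SimLE K) :
    (sumGraph G H).SimLE K := by
  refine simLE_iff.2 (sim_of_step fun a ws hs => ?_)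
  obtain ⟨us, h, rfl⟩ | ⟨us, h, rfl⟩ := sum_step_none.1 hs
  · obtain ⟨us', h1, h2⟩ := localSim_sim _ _ _ _ (simLE_iff.1 hG) _ _ h
    exact ⟨us', h1, List.forall₂_map_left_iff.2
      (h2.imp fun x _ h => (sum_inl_sim G H x).trans h)⟩
  · obtain ⟨us', h1, h2⟩ := localSim_sim _ _ _ _ (simLE_iff.1 hH) _ _ h
    exact ⟨us', h1, List.forall₂_map_left_iff.2
      (h2.imp fun x _ h => (sum_inr_sim G H x).trans h)⟩

theorem sum_comp_le (G G' : SyncGraph Sg p) (H : Fin p → SyncGraph Sg q) :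
    (compGraph (sumGraph G G') H).SimLE (sumGraph (compGraph G H) (compGraph G' H)) := by
  have key : ∀ K : SyncGraph Sg p, ∀ x : (sumGraph G G').V, ∀ y : K.V,
      Sim (sumGraph G G') K x y →
      Sim (compGraph (sumGraph G G') H) (compGraph K H) (compL _ H x) (compL K H y) := by
    intro K x y hxy
    refine ⟨fun x y => (∃ v v', x = compL _ H v ∧ y = compL K H v' ∧
        Sim (sumGraph G G') K v v') ∨
      (∃ i w, x = compR _ H i w ∧ y = compR K H i w), ?_, Or.inl ⟨_, _, rfl, rfl, hxy⟩⟩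
    rintro _ _ (⟨v, v', rfl, rfl, hv⟩ | ⟨i, w, rfl, rfl⟩) a ws hs
    · obtain ⟨σ, us, h1, rfl, rfl⟩ | ⟨i, us, h1, h2, rfl⟩ := comp_step_inl.1 hs
      · obtain ⟨us', h3, h4⟩ := localSim_sim _ _ _ _ hv _ _ h1
        exact ⟨_, comp_step_inl.2 (Or.inl ⟨σ, us', h3, rfl, rfl⟩),
          forall₂_map_both (by intro x y h; exact Or.inl ⟨x, y, rfl, rfl, h⟩) h4⟩
      · obtain ⟨us', h3, h4⟩ := localSim_sim _ _ _ _ hv _ _ h1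
        cases h4
        exact ⟨_, comp_step_inl.2 (Or.inr ⟨i, us, h3, h2, rfl⟩),
          List.forall₂_map_left_iff.2 (List.forall₂_map_right_iff.2
            (List.forall₂_same.2 fun x _ => Or.inr ⟨i, x, rfl, rfl⟩))⟩
    · obtain ⟨us, h1, rfl⟩ := comp_step_inr.1 hs
      exact ⟨_, comp_step_inr.2 ⟨us, h1, rfl⟩,
        List.forall₂_map_left_iff.2 (List.forall₂_map_right_iff.2
            (List.forall₂_same.2 fun x _ => Or.inr ⟨i, x, rfl, rfl⟩))⟩
  refine simLE_iff.2 (sim_of_step fun a ws hs => ?_)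
  obtain ⟨σ, us, h1, rfl, rfl⟩ | ⟨i, us, h1, h2, rfl⟩ := comp_step_inl.1 hs
  · obtain ⟨us', h3, rfl⟩ | ⟨us', h3, rfl⟩ := sum_step_none.1 h1
    · refine ⟨_, sum_step_none.2 (Or.inl ⟨_, comp_step_inl.2 (Or.inl ⟨σ, us', h3, rfl, rfl⟩),
        rfl⟩), ?_⟩
      rw [List.forall₂_map_left_iff, List.forall₂_map_left_iff, List.forall₂_map_right_iff,
        List.forall₂_map_right_iff]
      exact List.forall₂_same.2 fun x _ =>
        (key G _ x (sum_inl_sim _ _ _)).trans (sim_sum_inl _ _ _)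
    · refine ⟨_, sum_step_none.2 (Or.inr ⟨_, comp_step_inl.2 (Or.inl ⟨σ, us', h3, rfl, rfl⟩),
        rfl⟩), ?_⟩
      rw [List.forall₂_map_left_iff, List.forall₂_map_left_iff, List.forall₂_map_right_iff,
        List.forall₂_map_right_iff]
      exact List.forall₂_same.2 fun x _ =>
        (key G' _ x (sum_inr_sim _ _ _)).trans (sim_sum_inr _ _ _)
  · obtain ⟨us', h3, h5⟩ | ⟨us', h3, h5⟩ := sum_step_none.1 h1
    · obtain rfl := List.map_eq_nil_iff.1 h5.symm
      refine ⟨_, sum_step_none.2 (Or.inl ⟨_, comp_step_inl.2 (Or.inr ⟨i, us, h3, h2, rfl⟩),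
        rfl⟩), ?_⟩
      rw [List.forall₂_map_left_iff, List.forall₂_map_right_iff, List.forall₂_map_right_iff]
      exact List.forall₂_same.2 fun x _ =>
        ((comp_inr_sim _ _ _ x).trans (sim_comp_inr _ _ _ _)).trans (sim_sum_inl _ _ _)
    · obtain rfl := List.map_eq_nil_iff.1 h5.symm
      refine ⟨_, sum_step_none.2 (Or.inr ⟨_, comp_step_inl.2 (Or.inr ⟨i, us, h3, h2, rfl⟩),
        rfl⟩), ?_⟩
      rw [List.forall₂_map_left_iff, List.forall₂_map_right_iff, List.forall₂_map_right_iff]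
      exact List.forall₂_same.2 fun x _ =>
        ((comp_inr_sim _ _ _ x).trans (sim_comp_inr _ _ _ _)).trans (sim_sum_inr _ _ _)

/-! ### A graph for the dagger operation

It is only used to show that least solutions of fixed point equations exist and are regular. -/

end SyncGraph

/-- The embedding of the labels of trees `1 → p` into those of trees `1 → n + p`. -/
def Label.shift {Sg : ℕ → Type u} {p : ℕ} (n : ℕ) : Label Sg p → Label Sg (n + p)
  | .letter σ => .letter σ
  | .exit j => .exit (Fin.natAdd n j)

theorem Label.rank_shift {Sg : ℕ → Type u} {p : ℕ} (n : ℕ) (a : Label Sg p) :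
    (a.shift n).rank = a.rank := by
  cases a <;> rfl

theorem Label.exists_shift {Sg : ℕ → Type u} {n p : ℕ} (a : Label Sg (n + p))
    (h : ∀ j : Fin n, a ≠ .exit (Fin.castAdd p j)) : ∃ b : Label Sg p, b.shift n = a := by
  cases a with
  | letter σ => exact ⟨.letter σ, rfl⟩
  | exit i =>
    refine Fin.addCases (fun j h => ?_) (fun j _ => ?_) i h
    · exact absurd rfl (h j)
    · exact ⟨.exit j, rfl⟩

theorem Label.shift_injective {Sg : ℕ → Type u} {n p : ℕ} :
    Function.Injective (Label.shift (Sg := Sg) (p := p) n) := by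
  intro a b h
  cases a <;> cases b <;> simp_all [Label.shift]

theorem Label.shift_ne {Sg : ℕ → Type u} {n p : ℕ} (a : Label Sg p) (j : Fin n) :
    a.shift n ≠ .exit (Fin.castAdd p j) := by
  cases a with
  | letter σ => simp [Label.shift]
  | exit i =>
    simp only [Label.shift, ne_eq, Label.exit.injEq, Fin.ext_iff, Fin.val_natAdd, Fin.val_castAdd]
    omega

namespace SyncGraph

variable {Sg : ℕ → Type u} {p q r n : ℕ}

/-- `Jump F x y`: the vertex `y` is obtained from `x` by following exit edges to the roots. -/
inductive Jump (F : Fin n → SyncGraph Sg (n + p)) : (Σ i, (F i).V) → (Σ i, (F i).V) → Prop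
  | refl (x) : Jump F x x
  | head {i : Fin n} {v : (F i).V} {j : Fin n} {y : Σ i, (F i).V}
      (h : (F i).Step v (.exit (Fin.castAdd p j)) []) (h' : Jump F ⟨j, (F j).root⟩ y) :
      Jump F ⟨i, v⟩ y

/-- The disjoint union of the `F i`, where the exit edges labeled `ex_j` with `j ≤ n` are replaced
by the edges at the root of `F j`. -/
noncomputable def daggerGraph (F : Fin n → SyncGraph Sg (n + p)) (k : Fin n) : SyncGraph Sg p where
  V := Σ i, (F i).V
  E := {x : (Σ i, (F i).V) × (Σ i, (F i).E) // Jump F x.1 ⟨x.2.1, (F x.2.1).src x.2.2⟩ ∧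
    ∀ j : Fin n, (F x.2.1).lab x.2.2 ≠ .exit (Fin.castAdd p j)}
  countable_V := by
    have := fun i => (F i).countable_V
    infer_instance
  countable_E := by
    have := fun i => (F i).countable_V
    have := fun i => (F i).countable_E
    infer_instance
  root := ⟨k, (F k).root⟩
  src x := x.1.1
  lab x := (Label.exists_shift _ x.2.2).choose
  tgt x := ((F x.1.2.1).tgt x.1.2.2).map fun v => ⟨x.1.2.1, v⟩
  length_tgt x := by
    rw [List.length_map, (F x.1.2.1).length_tgt]
    exact (congrArg Label.rank (Label.exists_shift _ x.2.2).choose_spec).symm.trans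
      (Label.rank_shift n _)

/-- A vertex of `F i` in `daggerGraph F k`. -/
abbrev daggerV (F : Fin n → SyncGraph Sg (n + p)) (k i : Fin n) (v : (F i).V) :
    (daggerGraph F k).V :=
  ⟨i, v⟩

theorem dagger_step {F : Fin n → SyncGraph Sg (n + p)} {k i : Fin n} {v : (F i).V}
    {a : Label Sg p} {ws : List (daggerGraph F k).V} :
    (daggerGraph F k).Step (daggerV F k i v) a ws ↔
      ∃ i' v' us, Jump F ⟨i, v⟩ ⟨i', v'⟩ ∧ (F i').Step v' (a.shift n) us ∧
        ws = us.map (daggerV F k i') := by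
  constructor
  · rintro ⟨x, h, rfl, rfl⟩
    have h1 := x.2.1
    have h' : x.1.1 = ⟨i, v⟩ := h
    rw [h'] at h1
    exact ⟨_, _, _, h1, ⟨_, rfl, (Label.exists_shift _ x.2.2).choose_spec.symm, rfl⟩, rfl⟩
  · rintro ⟨i', _, _, h, ⟨e, rfl, h2, rfl⟩, rfl⟩
    have he : ∀ j : Fin n, (F i').lab e ≠ .exit (Fin.castAdd p j) := by
      intro j
      rw [h2]
      exact Label.shift_ne a j
    exact ⟨⟨(⟨i, v⟩, ⟨i', e⟩), h, he⟩, rfl,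
      Label.shift_injective ((Label.exists_shift _ he).choose_spec.trans h2), rfl⟩

theorem Sim.comp_inl {G : SyncGraph Sg p} {H : Fin p → SyncGraph Sg q} {K : SyncGraph Sg q}
    {v : G.V} {x : K.V} (h : Sim (compGraph G H) K (compL G H v) x) {i : Fin p}
    (hv : G.Step v (.exit i) []) : Sim (H i) K (H i).root x := by
  refine sim_of_step fun a us hs => ?_
  obtain ⟨us', h1, h2⟩ := localSim_sim _ _ _ _ h _ _ (comp_step_inl.2 (Or.inr ⟨i, us, hv, hs, rfl⟩))
  refine ⟨us', h1, ?_⟩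
  rw [List.forall₂_map_left_iff] at h2
  exact h2.imp fun y z hyz => (sim_comp_inr G H i y).trans hyz

/-- The trees `x_1, …, x_n` and `ex_1, …, ex_p`. -/
def withExits (X : Fin n → SyncGraph Sg p) : Fin (n + p) → SyncGraph Sg p :=
  Fin.append X fun j => exitGraph Sg j

theorem withExits_mono {X Y : Fin n → SyncGraph Sg p} (h : ∀ i, (X i).SimLE (Y i))
    (m : Fin (n + p)) : (withExits X m).SimLE (withExits Y m) := by
  refine Fin.addCases (fun i => ?_) (fun _ => ?_) m
  · simpa [withExits] using h i
  · simpa [withExits] using SimLE.refl _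

theorem dagger_le (F : Fin n → SyncGraph Sg (n + p)) (X : Fin n → SyncGraph Sg p)
    (hX : ∀ i, (compGraph (F i) (withExits X)).SimLE (X i)) (k : Fin n) :
    (daggerGraph F k).SimLE (X k) := by
  refine simLE_iff.2 ⟨fun y x => Sim (compGraph (F y.1) (withExits X)) (X k)
    (compL _ _ y.2) x, ?_, simLE_iff.1 (hX k)⟩
  have hjump : ∀ y z, Jump F y z → ∀ x,
      Sim (compGraph (F y.1) (withExits X)) (X k) (compL _ _ y.2) x →
      Sim (compGraph (F z.1) (withExits X)) (X k) (compL _ _ z.2) x := by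
    intro y z h
    induction h with
    | refl y => exact fun x hx => hx
    | @head i v j y h _ ih =>
      intro x hx
      have h1 := hx.comp_inl h
      rw [withExits, Fin.append_left] at h1
      exact ih x ((simLE_iff.1 (hX j)).trans h1)
  rintro ⟨i, v⟩ x hx a ws hs
  obtain ⟨i', v', us, h1, h2, rfl⟩ := dagger_step.1 hs
  have hx' := hjump _ _ h1 x hx
  cases a with
  | letter σ =>
    obtain ⟨us', h3, h4⟩ := localSim_sim _ _ _ _ hx' _ _
      (comp_step_inl.2 (Or.inl ⟨σ, us, h2, rfl, rfl⟩))
    refine ⟨us', h3, ?_⟩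
    rw [List.forall₂_map_left_iff] at h4 ⊢
    exact h4
  | exit j =>
    obtain rfl := h2.exit_nil
    have h3 := hx'.comp_inl h2
    rw [withExits, Fin.append_right] at h3
    obtain ⟨us', h4, h5⟩ := localSim_sim _ _ _ _ h3 _ _ (exit_step.2 ⟨rfl, rfl⟩)
    cases h5
    exact ⟨[], h4, List.Forall₂.nil⟩

theorem comp_dagger_le (F : Fin n → SyncGraph Sg (n + p)) (k : Fin n) :
    (compGraph (F k) (withExits (daggerGraph F))).SimLE (daggerGraph F k) := by
  refine simLE_iff.2 ⟨fun x y => (∃ v, x = compL _ _ v ∧ y = daggerV F k k v) ∨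
    (∃ m w, x = compR _ _ m w ∧ Sim (withExits (daggerGraph F) m) (daggerGraph F k) w y), ?_,
    Or.inl ⟨_, rfl, rfl⟩⟩
  rintro _ y (⟨v, rfl, rfl⟩ | ⟨m, w, rfl, h⟩) a ws hs
  · obtain ⟨σ, us, h1, rfl, rfl⟩ | ⟨m, us, h1, h2, rfl⟩ := comp_step_inl.1 hs
    · refine ⟨_, dagger_step.2 ⟨k, v, us, Jump.refl _, h1, rfl⟩, ?_⟩
      rw [List.forall₂_map_left_iff, List.forall₂_map_right_iff]
      exact List.forall₂_same.2 fun w _ => Or.inl ⟨w, rfl, rfl⟩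
    · have h3 : Sim (withExits (daggerGraph F) m) (daggerGraph F k)
          (withExits (daggerGraph F) m).root (daggerV F k k v) := by
        clear h2 us hs
        revert h1
        refine Fin.addCases (fun j h1 => ?_) (fun j h1 => ?_) m
        · rw [withExits, Fin.append_left]
          refine sim_of_step fun a us hs => ?_
          obtain ⟨i', v', us', h4, h5, rfl⟩ := dagger_step.1 hs
          refine ⟨_, dagger_step.2 ⟨i', v', us', Jump.head h1 h4, h5, rfl⟩, ?_⟩
          rw [List.forall₂_map_left_iff, List.forall₂_map_right_iff]
          exact List.forall₂_same.2 fun w _ => sim_refl (daggerGraph F k) _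
        · rw [withExits, Fin.append_right]
          refine sim_of_step fun a us hs => ?_
          obtain ⟨rfl, rfl⟩ := exit_step.1 hs
          exact ⟨[], dagger_step.2 ⟨k, v, [], Jump.refl _, h1, rfl⟩, List.Forall₂.nil⟩
      obtain ⟨us', h4, h5⟩ := localSim_sim _ _ _ _ h3 _ _ h2
      exact ⟨us', h4, List.forall₂_map_left_iff.2 (h5.imp fun x y h => Or.inr ⟨m, x, rfl, h⟩)⟩
  · obtain ⟨us, h1, rfl⟩ := comp_step_inr.1 hs
    obtain ⟨us', h4, h5⟩ := localSim_sim _ _ _ _ h _ _ h1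
    exact ⟨us', h4, List.forall₂_map_left_iff.2 (h5.imp fun x y h => Or.inr ⟨m, x, rfl, h⟩)⟩

theorem le_comp_dagger (F : Fin n → SyncGraph Sg (n + p)) (k : Fin n) :
    (daggerGraph F k).SimLE (compGraph (F k) (withExits (daggerGraph F))) :=
  dagger_le F (fun k => compGraph (F k) (withExits (daggerGraph F)))
    (fun _ => comp_mono (SimLE.refl _) (withExits_mono (comp_dagger_le F))) k

/-! ### Regular trees -/

theorem Iso.reach {G H : SyncGraph Sg p} (φ : Iso G H) {v w : G.V} (h : G.Reach v w) :
    H.Reach (φ.onV v) (φ.onV w) := by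
  refine Relation.ReflTransGen.lift (p := fun v w => ∃ e, H.src e = v ∧ w ∈ H.tgt e) φ.onV ?_ _ _ h
  rintro x y ⟨e, rfl, hy⟩
  exact ⟨φ.onE e, (φ.src e).symm, by rw [← φ.tgt e]; exact List.mem_map_of_mem hy⟩

/-- The identity isomorphism. -/
def Iso.refl (G : SyncGraph Sg p) : Iso G G :=
  ⟨Equiv.refl _, Equiv.refl _, rfl, fun _ => rfl, fun _ => rfl, fun _ => by simp⟩

/-- The inverse of an isomorphism. -/
def Iso.symm {G H : SyncGraph Sg p} (φ : Iso G H) : Iso H G where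
  onV := φ.onV.symm
  onE := φ.onE.symm
  root := by rw [← φ.root, Equiv.symm_apply_apply]
  src e := by rw [Equiv.symm_apply_eq, φ.src, Equiv.apply_symm_apply]
  lab e := by rw [φ.lab, Equiv.apply_symm_apply]
  tgt e := by
    have h := φ.tgt (φ.onE.symm e)
    rw [Equiv.apply_symm_apply] at h
    rw [← h, List.map_map]
    simp

/-- The composite of two isomorphisms. -/
def Iso.trans {G H K : SyncGraph Sg p} (φ : Iso G H) (ψ : Iso H K) : Iso G K where
  onV := φ.onV.trans ψ.onV
  onE := φ.onE.trans ψ.onE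
  root := by simp [φ.root, ψ.root]
  src e := by simp [φ.src, ψ.src]
  lab e := by simp [φ.lab, ψ.lab]
  tgt e := by simp [← ψ.tgt, ← φ.tgt]

/-- Two vertices are equivalent if the subtrees `G|_v` and `G|_w` are isomorphic. -/
def subSetoid (G : SyncGraph Sg p) : Setoid G.V where
  r v w := Nonempty (Iso (G.sub v) (G.sub w))
  iseqv := ⟨fun _ => ⟨Iso.refl _⟩, fun ⟨φ⟩ => ⟨φ.symm⟩, fun ⟨φ⟩ ⟨ψ⟩ => ⟨φ.trans ψ⟩⟩

end SyncGraph

/-- A synchronization tree is regular if it has finitely many subtrees up to isomorphism, and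
only finitely many letters appear as labels of its edges. -/
def SyncTree.IsRegular {Sg : ℕ → Type u} {p : ℕ} (t : SyncTree Sg p) : Prop :=
  Finite (Quotient t.subSetoid) ∧ {σ | ∃ e, t.lab e = .letter σ}.Finite

namespace SyncGraph

variable {Sg : ℕ → Type u} {p q r n : ℕ}

/-- The inclusion of a subtree. -/
abbrev subVal (G : SyncGraph Sg p) (v : G.V) : (G.sub v).V → G.V := Subtype.val

theorem subVal_injective (G : SyncGraph Sg p) (v : G.V) : Function.Injective (G.subVal v) :=
  Subtype.val_injective

theorem map_val_sub_tgt (G : SyncGraph Sg p) (v : G.V) (e : (G.sub v).E) :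
    ((G.sub v).tgt e).map (G.subVal v) = G.tgt e.1 :=
  List.map_map.trans (List.attach_map_subtype_val _)

theorem reach_sub (G : SyncGraph Sg p) {v : G.V} {x y : (G.sub v).V} :
    (G.sub v).Reach x y ↔ G.Reach x.1 y.1 := by
  constructor
  · intro h
    induction h with
    | refl => exact Relation.ReflTransGen.refl
    | tail _ h ih =>
      obtain ⟨e, rfl, hw⟩ := h
      refine ih.tail ⟨e.1, rfl, ?_⟩
      rw [← map_val_sub_tgt]
      exact List.mem_map_of_mem hw
  · intro h
    obtain ⟨y, hy⟩ := y
    dsimp only at h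
    induction h with
    | refl => exact Relation.ReflTransGen.refl
    | @tail b c h1 h ih =>
      obtain ⟨e, rfl, hw⟩ := h
      have he : G.Reach v (G.src e) := Relation.ReflTransGen.trans x.2 h1
      refine (ih he).tail ⟨⟨e, he⟩, rfl, ?_⟩
      rw [← map_val_sub_tgt G v ⟨e, he⟩] at hw
      obtain ⟨z, hz, rfl⟩ := List.mem_map.1 hw
      exact hz

/-- Subtrees of subtrees are subtrees. -/
def subSub (G : SyncGraph Sg p) (v : G.V) (w : (G.sub v).V) :
    Iso ((G.sub v).sub w) (G.sub w.1) where
  onV :=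
    { toFun := fun y => ⟨y.1.1, (reach_sub G).1 y.2⟩
      invFun := fun y => ⟨⟨y.1, Relation.ReflTransGen.trans w.2 y.2⟩, (reach_sub G).2 y.2⟩
      left_inv := fun _ => rfl
      right_inv := fun _ => rfl }
  onE :=
    { toFun := fun e => ⟨e.1.1, (reach_sub G).1 e.2⟩
      invFun := fun e => ⟨⟨e.1, Relation.ReflTransGen.trans w.2 e.2⟩, (reach_sub G).2 e.2⟩
      left_inv := fun _ => rfl
      right_inv := fun _ => rfl }
  root := rfl
  src _ := rfl
  lab _ := rfl
  tgt e := by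
    refine List.map_injective_iff.2 (subVal_injective G w.1) ?_
    refine Eq.trans ?_ (map_val_sub_tgt G w.1 _).symm
    refine List.map_map.trans ?_
    refine Eq.trans ?_ (map_val_sub_tgt G v e.1)
    rw [← map_val_sub_tgt (G.sub v) w e, List.map_map]
    rfl

/-- Isomorphisms restrict to subtrees. -/
def Iso.sub {G H : SyncGraph Sg p} (φ : Iso G H) (v : G.V) :
    Iso (G.sub v) (H.sub (φ.onV v)) where
  onV :=
    { toFun := fun y => ⟨φ.onV y.1, φ.reach y.2⟩
      invFun := fun y => ⟨φ.symm.onV y.1, by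
        have := φ.symm.reach y.2
        rwa [show φ.symm.onV (φ.onV v) = v from φ.onV.symm_apply_apply v] at this⟩
      left_inv := fun y => Subtype.ext (φ.onV.symm_apply_apply _)
      right_inv := fun y => Subtype.ext (φ.onV.apply_symm_apply _) }
  onE :=
    { toFun := fun e => ⟨φ.onE e.1, by rw [← φ.src]; exact φ.reach e.2⟩
      invFun := fun e => ⟨φ.symm.onE e.1, by
        have := φ.symm.reach e.2
        rw [show φ.symm.onV (φ.onV v) = v from φ.onV.symm_apply_apply v] at this
        rwa [← φ.symm.src]⟩
      left_inv := fun y => Subtype.ext (φ.onE.symm_apply_apply _)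
      right_inv := fun y => Subtype.ext (φ.onE.apply_symm_apply _) }
  root := rfl
  src e := Subtype.ext (φ.src e.1)
  lab e := φ.lab e.1
  tgt e := by
    refine List.map_injective_iff.2 (subVal_injective H _) ?_
    refine Eq.trans ?_ (map_val_sub_tgt H _ _).symm
    refine Eq.trans ?_ (φ.tgt e.1)
    rw [← map_val_sub_tgt G v e]
    refine List.map_map.trans (Eq.trans ?_ List.map_map.symm)
    rfl

theorem step_of_sub_iso {G : SyncGraph Sg p} {v v' : G.V} (φ : Iso (G.sub v) (G.sub v'))
    {a : Label Sg p} {ws : List G.V} (hs : G.Step v a ws) :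
    ∃ ws', G.Step v' a ws' ∧
      ws'.map (Quotient.mk G.subSetoid) = ws.map (Quotient.mk G.subSetoid) := by
  obtain ⟨e, rfl, rfl, rfl⟩ := hs
  let b : (G.sub (G.src e)).E := ⟨e, Relation.ReflTransGen.refl⟩
  refine ⟨G.tgt (φ.onE b).1, ⟨(φ.onE b).1, ?_, (φ.lab b).symm, rfl⟩, ?_⟩
  · have h1 := φ.src b
    have h2 : φ.onV ((G.sub (G.src e)).src b) = (G.sub v').root := φ.root
    rw [h2] at h1
    exact (congrArg Subtype.val h1).symm
  · rw [← map_val_sub_tgt, ← φ.tgt b]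
    change _ = List.map _ (G.tgt b.1)
    rw [← map_val_sub_tgt, List.map_map, List.map_map, List.map_map]
    refine List.map_congr_left fun w _ => ?_
    refine Quotient.sound ⟨?_⟩
    exact ((subSub G v' (φ.onV w)).symm.trans (φ.sub w).symm).trans (subSub G _ w)

/-- The source, label and targets of an edge, up to isomorphism of subtrees. -/
def edgeData (G : SyncGraph Sg p) (e : G.E) :
    Quotient G.subSetoid × Label Sg p × List (Quotient G.subSetoid) :=
  (Quotient.mk _ (G.src e), G.lab e, (G.tgt e).map (Quotient.mk _))

theorem kerLift_mk (G : SyncGraph Sg p) (e : G.E) :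
    Setoid.kerLift G.edgeData (Quotient.mk _ e) = G.edgeData e := rfl

/-- The quotient of a graph that identifies vertices with isomorphic subtrees, and edges
with the same source, label and targets. -/
def quotGraph (G : SyncGraph Sg p) : SyncGraph Sg p where
  V := Quotient G.subSetoid
  E := Quotient (Setoid.ker G.edgeData)
  countable_V := have := G.countable_V; inferInstance
  countable_E := have := G.countable_E; inferInstance
  root := Quotient.mk _ G.root
  src x := (Setoid.kerLift G.edgeData x).1
  lab x := (Setoid.kerLift G.edgeData x).2.1
  tgt x := (Setoid.kerLift G.edgeData x).2.2
  length_tgt x := by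
    obtain ⟨e, rfl⟩ := Quotient.exists_rep x
    rw [kerLift_mk]
    simpa [edgeData] using G.length_tgt e

theorem simLE_quotGraph (G : SyncGraph Sg p) : G.SimLE G.quotGraph := by
  refine ⟨fun v q => q = Quotient.mk _ v, rfl, ?_⟩
  rintro e _ rfl
  exact ⟨Quotient.mk _ e, rfl, rfl, forall₂_map_right (by intro _; exact rfl) _⟩

theorem quotGraph_simLE (G : SyncGraph Sg p) : G.quotGraph.SimLE G := by
  refine ⟨fun q v => q = Quotient.mk _ v, rfl, ?_⟩
  intro x v hv
  obtain ⟨e, rfl⟩ := Quotient.exists_rep x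
  have hv' : Quotient.mk G.subSetoid (G.src e) = Quotient.mk _ v := hv
  obtain ⟨φ⟩ := Quotient.exact hv'
  obtain ⟨_, ⟨e', rfl, h1, rfl⟩, h2⟩ := step_of_sub_iso φ ⟨e, rfl, rfl, rfl⟩
  refine ⟨e', rfl, h1, ?_⟩
  change List.Forall₂ _ ((G.tgt e).map (Quotient.mk _)) _
  rw [← h2]
  exact forall₂_map_left (by intro _; exact rfl) _

theorem quotGraph_finite {t : SyncTree Sg p} (ht : t.IsRegular) :
    Finite t.quotGraph.V ∧ Finite t.quotGraph.E := by
  have h1 : Finite (Quotient t.subSetoid) := ht.1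
  refine ⟨h1, ?_⟩
  let L : Set (Label Sg p) := Label.letter '' {σ | ∃ e, t.lab e = .letter σ} ∪
    Set.range Label.exit
  have hL : L.Finite := (ht.2.image _).union (Set.finite_range _)
  let M : Set (List (Quotient t.subSetoid)) := ⋃ a ∈ L, {l | l.length = a.rank}
  have hM : M.Finite := hL.biUnion fun a _ => List.finite_length_eq _ _
  have hS : ((Set.univ : Set (Quotient t.subSetoid)) ×ˢ (L ×ˢ M)).Finite :=
    Set.finite_univ.prod (hL.prod hM)
  have hmem : ∀ x : t.quotGraph.E, Setoid.kerLift t.edgeData x ∈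
      (Set.univ : Set (Quotient t.subSetoid)) ×ˢ (L ×ˢ M) := by
    intro x
    obtain ⟨e, rfl⟩ := Quotient.exists_rep x
    rw [kerLift_mk]
    have he : t.lab e ∈ L := by
      cases h : t.lab e with
      | letter σ => exact Or.inl ⟨σ, ⟨e, h⟩, rfl⟩
      | exit i => exact Or.inr ⟨i, rfl⟩
    refine ⟨Set.mem_univ _, he, Set.mem_biUnion he ?_⟩
    simpa [edgeData] using t.length_tgt e
  have := hS.to_subtype
  exact Finite.of_injective (fun x => (⟨_, hmem x⟩ :
    ((Set.univ : Set (Quotient t.subSetoid)) ×ˢ (L ×ˢ M) : Set _)))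
    fun x y h => Setoid.kerLift_injective _ (congrArg Subtype.val h)

theorem reach_unfold {G : SyncGraph Sg p} {u w : G.unfoldGraph.V} (h : G.unfoldGraph.Reach u w) :
    ∃ m, w.1 = u.1 ++ m := by
  induction h with
  | refl => exact ⟨[], by simp⟩
  | tail _ h ih =>
    obtain ⟨a, rfl, hw⟩ := h
    obtain ⟨m, hm⟩ := ih
    obtain ⟨i, hi⟩ := List.mem_iff_getElem?.1 hw
    refine ⟨m ++ [(a.1.2, i)], ?_⟩
    rw [(unfoldGraph_getElem? G a i _).1 hi, ← List.append_assoc, ← hm]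
    rfl

theorem unfold_reach {G : SyncGraph Sg p} (l m : List (G.E × ℕ)) (x y : G.V)
    (hl : G.IsPath G.root l x) (hm : G.IsPath G.root (l ++ m) y) :
    G.unfoldGraph.Reach ⟨l, x, hl⟩ ⟨l ++ m, y, hm⟩ := by
  induction m using List.reverseRecOn generalizing y with
  | nil =>
    have h : (⟨l ++ [], y, hm⟩ : G.unfoldGraph.V) = ⟨l, x, hl⟩ := Subtype.ext (List.append_nil l)
    rw [h]
    exact Relation.ReflTransGen.refl
  | append_singleton m a ih =>
    obtain ⟨e, i⟩ := a
    have hm' := hm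
    rw [← List.append_assoc, isPath_concat] at hm'
    let b : G.unfoldGraph.E := ⟨(l ++ m, e), hm'.1⟩
    refine (ih _ hm'.1).tail ⟨b, rfl, ?_⟩
    exact List.mem_of_getElem? ((unfoldGraph_getElem? G b i _).2 (List.append_assoc l m _).symm)

theorem isPath_move {G : SyncGraph Sg p} {l l' m : List (G.E × ℕ)} {x y : G.V}
    (hl : G.IsPath G.root l x) (hl' : G.IsPath G.root l' x) (h : G.IsPath G.root (l ++ m) y) :
    G.IsPath G.root (l' ++ m) y := by
  obtain ⟨z, h1, h2⟩ := (isPath_append G).1 h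
  cases h1.unique hl
  exact (isPath_append G).2 ⟨_, hl', h2⟩

/-- In an unfolding, the subtrees at two paths with the same end are isomorphic. -/
def unfoldMoveV {G : SyncGraph Sg p} {l l' : List (G.E × ℕ)} {x : G.V}
    (hl : G.IsPath G.root l x) (hl' : G.IsPath G.root l' x)
    (w : (G.unfoldGraph.sub ⟨l, x, hl⟩).V) : (G.unfoldGraph.sub ⟨l', x, hl'⟩).V :=
  have h : ∃ y, G.IsPath G.root (l' ++ w.1.1.drop l.length) y := by
    obtain ⟨⟨k, y, hk⟩, hw⟩ := w
    obtain ⟨m, hm⟩ := reach_unfold hw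
    dsimp only at hm
    subst hm
    rw [List.drop_left]
    exact ⟨y, isPath_move hl hl' hk⟩
  ⟨⟨l' ++ w.1.1.drop l.length, h⟩, unfold_reach _ _ x _ hl' h.choose_spec⟩

theorem unfoldMoveV_move {G : SyncGraph Sg p} {l l' : List (G.E × ℕ)} {x : G.V}
    (hl : G.IsPath G.root l x) (hl' : G.IsPath G.root l' x)
    (w : (G.unfoldGraph.sub ⟨l, x, hl⟩).V) : unfoldMoveV hl' hl (unfoldMoveV hl hl' w) = w := by
  obtain ⟨⟨k, y, hk⟩, hw⟩ := w
  obtain ⟨m, hm⟩ := reach_unfold hw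
  dsimp only at hm
  subst hm
  refine Subtype.ext (Subtype.ext ?_)
  simp [unfoldMoveV]

/-- The action on edges that belongs to `unfoldMoveV`. -/
def unfoldMoveE {G : SyncGraph Sg p} {l l' : List (G.E × ℕ)} {x : G.V}
    (hl : G.IsPath G.root l x) (hl' : G.IsPath G.root l' x)
    (a : (G.unfoldGraph.sub ⟨l, x, hl⟩).E) : (G.unfoldGraph.sub ⟨l', x, hl'⟩).E :=
  have h : G.IsPath G.root (l' ++ a.1.1.1.drop l.length) (G.src a.1.1.2) := by
    obtain ⟨⟨⟨k, e⟩, hk⟩, hw⟩ := a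
    obtain ⟨m, hm⟩ := reach_unfold hw
    change k = l ++ m at hm
    subst hm
    rw [List.drop_left]
    exact isPath_move hl hl' hk
  ⟨⟨(l' ++ a.1.1.1.drop l.length, a.1.1.2), h⟩, unfold_reach _ _ x _ hl' h⟩

theorem unfoldMoveE_move {G : SyncGraph Sg p} {l l' : List (G.E × ℕ)} {x : G.V}
    (hl : G.IsPath G.root l x) (hl' : G.IsPath G.root l' x)
    (a : (G.unfoldGraph.sub ⟨l, x, hl⟩).E) : unfoldMoveE hl' hl (unfoldMoveE hl hl' a) = a := by
  obtain ⟨⟨⟨k, e⟩, hk⟩, hw⟩ := a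
  obtain ⟨m, hm⟩ := reach_unfold hw
  change k = l ++ m at hm
  subst hm
  refine Subtype.ext (Subtype.ext (Prod.ext ?_ rfl))
  simp [unfoldMoveE]

/-- In an unfolding, the subtrees at two paths with the same end are isomorphic. -/
def unfoldMove {G : SyncGraph Sg p} {l l' : List (G.E × ℕ)} {x : G.V}
    (hl : G.IsPath G.root l x) (hl' : G.IsPath G.root l' x) :
    Iso (G.unfoldGraph.sub ⟨l, x, hl⟩) (G.unfoldGraph.sub ⟨l', x, hl'⟩) where
  onV := ⟨unfoldMoveV hl hl', unfoldMoveV hl' hl, unfoldMoveV_move hl hl', unfoldMoveV_move hl' hl⟩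
  onE := ⟨unfoldMoveE hl hl', unfoldMoveE hl' hl, unfoldMoveE_move hl hl', unfoldMoveE_move hl' hl⟩
  root := by
    refine Subtype.ext (Subtype.ext ?_)
    change l' ++ l.drop l.length = l'
    simp
  src _ := rfl
  lab _ := rfl
  tgt a := by
    refine List.map_injective_iff.2 (subVal_injective _ _) ?_
    refine Eq.trans ?_ (map_val_sub_tgt _ _ _).symm
    obtain ⟨⟨⟨k, e⟩, hk⟩, hw⟩ := a
    obtain ⟨m, hm⟩ := reach_unfold hw
    change k = l ++ m at hm
    subst hm
    refine List.map_injective_iff.2 Subtype.val_injective ?_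
    refine (List.map_map.trans List.map_map).trans ?_
    let f : G.unfoldGraph.V → List (G.E × ℕ) := fun w => l' ++ w.1.drop l.length
    have h1 := congrArg (List.map f)
      (map_val_sub_tgt G.unfoldGraph ⟨l, x, hl⟩ ⟨⟨(l ++ m, e), hk⟩, hw⟩)
    refine (List.map_map.symm.trans h1).trans ?_
    refine List.map_ofFn.trans (Eq.trans ?_ List.map_ofFn.symm)
    refine congrArg List.ofFn (funext fun i => ?_)
    change l' ++ List.drop l.length (l ++ m ++ [(e, (i : ℕ))]) =
      l' ++ List.drop l.length (l ++ m) ++ [(e, (i : ℕ))]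
    rw [List.append_assoc l, List.drop_left, List.drop_left, List.append_assoc]

theorem unfold_isRegular (G : SyncGraph Sg p) [Finite G.V] [Finite G.E] : G.unfold.IsRegular := by
  constructor
  · let f : Quotient G.unfold.subSetoid → G.V := fun x => x.out.2.choose
    refine Finite.of_injective f fun x y hxy => ?_
    rw [← Quotient.out_eq x, ← Quotient.out_eq y]
    have hx := x.out.2.choose_spec
    have hy := y.out.2.choose_spec
    change x.out.2.choose = y.out.2.choose at hxy
    rw [← hxy] at hy
    exact Quotient.sound ⟨unfoldMove hx hy⟩
  · refine ((Set.finite_range G.lab).preimage (f := Label.letter)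
      (fun a _ b _ h => Label.letter.inj h)).subset ?_
    rintro σ ⟨a, ha⟩
    exact ⟨a.1.2, ha⟩

end SyncGraph

/-! ## Simulation equivalence classes -/

namespace SyncTree

variable {Sg : ℕ → Type u} {p q : ℕ}

/-- The tree `0_{1,p}` without edges. -/
def zero (Sg : ℕ → Type u) (p : ℕ) : SyncTree Sg p :=
  (SyncGraph.zeroGraph Sg p).unfold

/-- The tree `i_p` with a single edge, which is labeled `ex_i`. -/
def exit (Sg : ℕ → Type u) {p : ℕ} (i : Fin p) : SyncTree Sg p :=
  (SyncGraph.exitGraph Sg i).unfold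

/-- The tree `1 → n` of a letter of rank `n`. -/
def letter {n : ℕ} (σ : Sg n) : SyncTree Sg n :=
  (SyncGraph.letterGraph σ).unfold

/-- The sum `t + t'`: disjoint copies of `t` and `t'` with their roots merged. -/
def sum (t t' : SyncTree Sg p) : SyncTree Sg p :=
  (SyncGraph.sumGraph t.toSyncGraph t'.toSyncGraph).unfold

/-- The composite `t · (s_1, …, s_p)`: each edge of `t` labeled `ex_i` is replaced by a copy
of `s_i`, whose root is merged with the source of the edge. -/
def comp (t : SyncTree Sg p) (s : Fin p → SyncTree Sg q) : SyncTree Sg q :=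
  (SyncGraph.compGraph t.toSyncGraph fun i => (s i).toSyncGraph).unfold

end SyncTree

/-- Simulation equivalence of synchronization trees `1 → p`. -/
def simSetoid (Sg : ℕ → Type u) (p : ℕ) : Setoid (SyncTree Sg p) where
  r t t' := t.SimLE t'.toSyncGraph ∧ t'.SimLE t.toSyncGraph
  iseqv := ⟨fun _ => ⟨SyncGraph.SimLE.refl _, SyncGraph.SimLE.refl _⟩, fun h => ⟨h.2, h.1⟩,
    fun h h' => ⟨h.1.trans h'.1, h'.2.trans h.2⟩⟩

/-- The simulation equivalence classes of synchronization trees `1 → p`. -/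
def SimClass (Sg : ℕ → Type u) (p : ℕ) : Type (max 1 u) :=
  Quotient (simSetoid Sg p)

/-- The simulation equivalence class of a synchronization tree. -/
def SyncTree.cls {Sg : ℕ → Type u} {p : ℕ} (t : SyncTree Sg p) : SimClass Sg p :=
  Quotient.mk (simSetoid Sg p) t

namespace SimClass

open SyncGraph

variable {Sg : ℕ → Type u} {n p q r : ℕ}

/-- A representative of a class. -/
noncomputable def rep (x : SimClass Sg p) : SyncTree Sg p :=
  Quotient.out (s := simSetoid Sg p) x

theorem cls_rep (x : SimClass Sg p) : x.rep.cls = x :=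
  Quotient.out_eq (s := simSetoid Sg p) x

theorem cls_eq_iff {t t' : SyncTree Sg p} :
    t.cls = t'.cls ↔ t.SimLE t'.toSyncGraph ∧ t'.SimLE t.toSyncGraph :=
  Quotient.eq (r := simSetoid Sg p)

theorem rep_cls (t : SyncTree Sg p) :
    t.cls.rep.SimLE t.toSyncGraph ∧ t.SimLE t.cls.rep.toSyncGraph :=
  cls_eq_iff.1 t.cls.cls_rep

/-- The sum of two classes. -/
noncomputable def sum (x y : SimClass Sg p) : SimClass Sg p :=
  (x.rep.sum y.rep).cls

/-- The composite of classes. -/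
noncomputable def comp (x : SimClass Sg p) (y : Fin p → SimClass Sg q) : SimClass Sg q :=
  (x.rep.comp fun i => (y i).rep).cls

/-- The class of the unfolding of a graph. -/
def ofGraph (G : SyncGraph Sg p) : SimClass Sg p :=
  G.unfold.cls

theorem ofGraph_eq_iff {G H : SyncGraph Sg p} :
    ofGraph G = ofGraph H ↔ G.SimLE H ∧ H.SimLE G := by
  rw [ofGraph, ofGraph, cls_eq_iff]
  have hG := unfold_simLE G
  have hG' := simLE_unfold G
  have hH := unfold_simLE H
  have hH' := simLE_unfold H
  exact ⟨fun h => ⟨hG'.trans (h.1.trans hH), hH'.trans (h.2.trans hG)⟩,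
    fun h => ⟨hG.trans (h.1.trans hH'), hH.trans (h.2.trans hG')⟩⟩

theorem ofGraph_tree (t : SyncTree Sg p) : ofGraph t.toSyncGraph = t.cls :=
  cls_eq_iff.2 ⟨unfold_simLE _, simLE_unfold _⟩

theorem ofGraph_rep (x : SimClass Sg p) : ofGraph x.rep.toSyncGraph = x := by
  rw [ofGraph_tree, cls_rep]

theorem rep_ofGraph (G : SyncGraph Sg p) :
    (ofGraph G).rep.SimLE G ∧ G.SimLE (ofGraph G).rep.toSyncGraph :=
  ofGraph_eq_iff.1 (ofGraph_rep _)

theorem exists_graph (x : SimClass Sg p) : ∃ G, ofGraph G = x :=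
  ⟨_, x.ofGraph_rep⟩

theorem sum_ofGraph (G H : SyncGraph Sg p) :
    sum (ofGraph G) (ofGraph H) = ofGraph (sumGraph G H) := by
  refine ofGraph_eq_iff.2 ⟨?_, ?_⟩
  · exact sum_le ((rep_ofGraph G).1.trans (le_sum_left _ _))
      ((rep_ofGraph H).1.trans (le_sum_right _ _))
  · exact sum_le ((rep_ofGraph G).2.trans (le_sum_left _ _))
      ((rep_ofGraph H).2.trans (le_sum_right _ _))

theorem comp_ofGraph (G : SyncGraph Sg p) (H : Fin p → SyncGraph Sg q) :
    comp (ofGraph G) (fun i => ofGraph (H i)) = ofGraph (compGraph G H) :=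
  ofGraph_eq_iff.2 ⟨comp_mono (rep_ofGraph G).1 fun i => (rep_ofGraph (H i)).1,
    comp_mono (rep_ofGraph G).2 fun i => (rep_ofGraph (H i)).2⟩

/-- Sum and composition of classes do not depend on the representatives. -/
theorem sum_cls (t t' : SyncTree Sg p) : sum t.cls t'.cls = (t.sum t').cls := by
  rw [← ofGraph_tree, ← ofGraph_tree, sum_ofGraph]
  rfl

theorem comp_cls (t : SyncTree Sg p) (s : Fin p → SyncTree Sg q) :
    comp t.cls (fun i => (s i).cls) = (t.comp s).cls := by
  simp only [← ofGraph_tree t, ← ofGraph_tree (s _), comp_ofGraph]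
  rfl

theorem sum_eq_iff {G H : SyncGraph Sg p} :
    sum (ofGraph G) (ofGraph H) = ofGraph H ↔ G.SimLE H := by
  rw [sum_ofGraph, ofGraph_eq_iff]
  exact ⟨fun h => (le_sum_left _ _).trans h.1, fun h => ⟨sum_le h (SimLE.refl _),
    le_sum_right _ _⟩⟩

theorem sum_assoc (x y z : SimClass Sg p) : sum (sum x y) z = sum x (sum y z) := by
  obtain ⟨G, rfl⟩ := x.exists_graph
  obtain ⟨H, rfl⟩ := y.exists_graph
  obtain ⟨K, rfl⟩ := z.exists_graph
  simp only [sum_ofGraph]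
  have a1 := le_sum_left G H
  have a2 := le_sum_right G H
  have a3 := le_sum_left H K
  have a4 := le_sum_right H K
  have a5 := le_sum_left (sumGraph G H) K
  have a6 := le_sum_right (sumGraph G H) K
  have a7 := le_sum_left G (sumGraph H K)
  have a8 := le_sum_right G (sumGraph H K)
  exact ofGraph_eq_iff.2 ⟨sum_le (sum_le a7 (a3.trans a8)) (a4.trans a8),
    sum_le (a1.trans a5) (sum_le (a2.trans a5) a6)⟩

theorem sum_comm (x y : SimClass Sg p) : sum x y = sum y x := by
  obtain ⟨G, rfl⟩ := x.exists_graph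
  obtain ⟨H, rfl⟩ := y.exists_graph
  simp only [sum_ofGraph]
  exact ofGraph_eq_iff.2 ⟨sum_le (le_sum_right _ _) (le_sum_left _ _),
    sum_le (le_sum_right _ _) (le_sum_left _ _)⟩

theorem zero_sum (x : SimClass Sg p) : sum (SyncTree.zero Sg p).cls x = x := by
  obtain ⟨G, rfl⟩ := x.exists_graph
  exact sum_eq_iff.2 (SyncGraph.zero_le G)

theorem sum_self (x : SimClass Sg p) : sum x x = x := by
  obtain ⟨G, rfl⟩ := x.exists_graph
  exact sum_eq_iff.2 (SimLE.refl G)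

theorem comp_assoc (x : SimClass Sg p) (y : Fin p → SimClass Sg q) (z : Fin q → SimClass Sg r) :
    comp (comp x y) z = comp x fun i => comp (y i) z := by
  obtain ⟨G, rfl⟩ := x.exists_graph
  choose H hH using fun i => (y i).exists_graph
  choose K hK using fun i => (z i).exists_graph
  obtain rfl := funext hH
  obtain rfl := funext hK
  simp only [comp_ofGraph]
  exact ofGraph_eq_iff.2 ⟨comp_assoc_le _ _ _, le_comp_assoc _ _ _⟩

theorem comp_exit (x : SimClass Sg p) : comp x (fun i => (SyncTree.exit Sg i).cls) = x := by
  obtain ⟨G, rfl⟩ := x.exists_graph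
  exact (comp_ofGraph G fun i => exitGraph Sg i).trans
    (ofGraph_eq_iff.2 ⟨comp_exit_le _, le_comp_exit _⟩)

theorem exit_comp (i : Fin p) (y : Fin p → SimClass Sg q) :
    comp (SyncTree.exit Sg i).cls y = y i := by
  choose H hH using fun i => (y i).exists_graph
  obtain rfl := funext hH
  exact (comp_ofGraph (exitGraph Sg i) H).trans
    (ofGraph_eq_iff.2 ⟨exit_comp_le _ _, le_exit_comp _ _⟩)

theorem sum_comp (x x' : SimClass Sg p) (y : Fin p → SimClass Sg q) :
    comp (sum x x') y = sum (comp x y) (comp x' y) := by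
  obtain ⟨G, rfl⟩ := x.exists_graph
  obtain ⟨G', rfl⟩ := x'.exists_graph
  choose H hH using fun i => (y i).exists_graph
  obtain rfl := funext hH
  simp only [comp_ofGraph, sum_ofGraph]
  exact ofGraph_eq_iff.2 ⟨sum_comp_le _ _ _,
    sum_le (comp_mono (le_sum_left _ _) fun _ => SimLE.refl _)
      (comp_mono (le_sum_right _ _) fun _ => SimLE.refl _)⟩

theorem zero_comp (y : Fin p → SimClass Sg q) :
    comp (SyncTree.zero Sg p).cls y = (SyncTree.zero Sg q).cls := by
  choose H hH using fun i => (y i).exists_graph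
  obtain rfl := funext hH
  exact (comp_ofGraph (zeroGraph Sg p) H).trans
    (ofGraph_eq_iff.2 ⟨zero_comp_le _, SyncGraph.zero_le _⟩)

/-- A class is regular if it contains a regular tree. -/
def IsRegular (x : SimClass Sg p) : Prop :=
  ∃ t : SyncTree Sg p, t.IsRegular ∧ t.cls = x

theorem isRegular_iff {x : SimClass Sg p} :
    x.IsRegular ↔ ∃ G : SyncGraph Sg p, Finite G.V ∧ Finite G.E ∧ ofGraph G = x := by
  constructor
  · rintro ⟨t, ht, rfl⟩
    obtain ⟨h1, h2⟩ := quotGraph_finite ht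
    refine ⟨_, h1, h2, ?_⟩
    rw [← ofGraph_tree]
    exact ofGraph_eq_iff.2 ⟨quotGraph_simLE _, simLE_quotGraph _⟩
  · rintro ⟨G, h1, h2, rfl⟩
    exact ⟨G.unfold, unfold_isRegular G, rfl⟩

theorem isRegular_zero : (SyncTree.zero Sg p).cls.IsRegular :=
  isRegular_iff.2 ⟨zeroGraph Sg p, inferInstanceAs (Finite Unit), inferInstanceAs (Finite Empty),
    rfl⟩

theorem isRegular_exit (i : Fin p) : (SyncTree.exit Sg i).cls.IsRegular :=
  isRegular_iff.2 ⟨exitGraph Sg i, inferInstanceAs (Finite Unit), inferInstanceAs (Finite Unit),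
    rfl⟩

theorem isRegular_letter (σ : Sg n) : (SyncTree.letter σ).cls.IsRegular :=
  isRegular_iff.2 ⟨letterGraph σ, inferInstanceAs (Finite (Option (Fin n))),
    inferInstanceAs (Finite (Option (Fin n))), rfl⟩

theorem IsRegular.sum {x y : SimClass Sg p} (hx : x.IsRegular) (hy : y.IsRegular) :
    (x.sum y).IsRegular := by
  obtain ⟨G, h1, h2, rfl⟩ := isRegular_iff.1 hx
  obtain ⟨H, h3, h4, rfl⟩ := isRegular_iff.1 hy
  refine isRegular_iff.2 ⟨sumGraph G H, ?_, ?_, (sum_ofGraph G H).symm⟩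
  · exact inferInstanceAs (Finite (Option (G.V ⊕ H.V)))
  · exact inferInstanceAs (Finite ((G.E ⊕ H.E) ⊕
      ({e : G.E // G.src e = G.root} ⊕ {e : H.E // H.src e = H.root})))

theorem IsRegular.comp {x : SimClass Sg p} {y : Fin p → SimClass Sg q} (hx : x.IsRegular)
    (hy : ∀ i, (y i).IsRegular) : (x.comp y).IsRegular := by
  obtain ⟨G, h1, h2, rfl⟩ := isRegular_iff.1 hx
  choose H h3 h4 h5 using fun i => isRegular_iff.1 (hy i)
  obtain rfl := funext h5
  refine isRegular_iff.2 ⟨compGraph G H, ?_, ?_, (comp_ofGraph G H).symm⟩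
  · exact inferInstanceAs (Finite (G.V ⊕ Σ i, (H i).V))
  · exact inferInstanceAs (Finite ({e : G.E // ∀ i, G.lab e ≠ .exit i} ⊕
      ((Σ i : Fin p, {e : G.E // G.lab e = .exit i} × {e : (H i).E // (H i).src e = (H i).root}) ⊕
        Σ i : Fin p, (H i).E)))

/-- The classes `x_1, …, x_n` and those of `ex_1, …, ex_p`. -/
def withExits (x : Fin n → SimClass Sg p) : Fin (n + p) → SimClass Sg p :=
  Fin.append x fun j => (SyncTree.exit Sg j).cls

theorem withExits_left (x : Fin n → SimClass Sg p) (i : Fin n) :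
    withExits x (Fin.castAdd p i) = x i :=
  Fin.append_left _ _ i

theorem withExits_right (x : Fin n → SimClass Sg p) (i : Fin p) :
    withExits x (Fin.natAdd n i) = (SyncTree.exit Sg i).cls :=
  Fin.append_right _ _ i

theorem withExits_ofGraph (X : Fin n → SyncGraph Sg p) :
    withExits (fun i => ofGraph (X i)) = fun i => ofGraph (SyncGraph.withExits X i) := by
  funext m
  refine Fin.addCases (fun i => ?_) (fun i => ?_) m
  · simp [withExits, SyncGraph.withExits]
  · simp [withExits, SyncGraph.withExits]
    rfl

/-- Least solutions of systems of fixed point equations exist, and they are regular if the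
right-hand sides are. -/
theorem exists_least (f : Fin n → SimClass Sg (n + p)) :
    ∃ x : Fin n → SimClass Sg p, (∀ i, x i = comp (f i) (withExits x)) ∧
      (∀ y : Fin n → SimClass Sg p, (∀ i, y i = comp (f i) (withExits y)) →
        ∀ i, sum (x i) (y i) = y i) ∧
      ((∀ i, (f i).IsRegular) → ∀ i, (x i).IsRegular) := by
  have key : ∀ F : Fin n → SyncGraph Sg (n + p), (∀ i, ofGraph (F i) = f i) →
      (∀ i, ofGraph (daggerGraph F i) =
        comp (f i) (withExits fun i => ofGraph (daggerGraph F i))) ∧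
      (∀ y : Fin n → SimClass Sg p, (∀ i, y i = comp (f i) (withExits y)) →
        ∀ i, sum (ofGraph (daggerGraph F i)) (y i) = y i) := by
    intro F hF
    obtain rfl := funext hF
    constructor
    · intro i
      rw [withExits_ofGraph, comp_ofGraph]
      exact ofGraph_eq_iff.2 ⟨le_comp_dagger F i, comp_dagger_le F i⟩
    · intro y hy i
      choose Y hY using fun i => (y i).exists_graph
      obtain rfl := funext hY
      refine sum_eq_iff.2 (dagger_le F Y (fun j => ?_) i)
      have h := hy j
      rw [withExits_ofGraph, comp_ofGraph] at h
      exact (ofGraph_eq_iff.1 h).2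
  by_cases hreg : ∀ i, (f i).IsRegular
  · choose F h1 h2 h3 using fun i => isRegular_iff.1 (hreg i)
    refine ⟨_, (key F h3).1, (key F h3).2, fun _ i => isRegular_iff.2 ⟨daggerGraph F i, ?_, ?_,
      rfl⟩⟩
    · exact inferInstanceAs (Finite (Σ i, (F i).V))
    · exact inferInstanceAs (Finite {x : (Σ i, (F i).V) × (Σ i, (F i).E) //
        Jump F x.1 ⟨x.2.1, (F x.2.1).src x.2.2⟩ ∧
          ∀ j : Fin n, (F x.2.1).lab x.2.2 ≠ .exit (Fin.castAdd p j)})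
  · choose F hF using fun i => (f i).exists_graph
    exact ⟨_, (key F hF).1, (key F hF).2, fun h => absurd h hreg⟩

end SimClass

/-! ## The theories of synchronization trees modulo simulation equivalence -/

/-- The theory of simulation equivalence classes of synchronization trees over `Sg`.
A morphism `n → p` is an `n`-tuple of classes of trees `1 → p`. -/
noncomputable def SST (Sg : ℕ → Type u) : IdemGroveTheory.{max 1 u} where
  Hom n p := Fin n → SimClass Sg p
  comp f g := fun i => (f i).comp g
  one _ := fun i => (SyncTree.exit Sg i).cls
  inj i := fun _ => (SyncTree.exit Sg i).cls
  tup f := fun i => f i 0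
  comp_assoc f g h := funext fun i => (f i).comp_assoc g h
  one_comp f := funext fun i => SimClass.exit_comp i f
  comp_one f := funext fun i => (f i).comp_exit
  inj_tup f i := funext fun j => by
    obtain rfl := Subsingleton.elim j 0
    exact SimClass.exit_comp i _
  tup_inj f := funext fun i => SimClass.exit_comp i f
  one_one := funext fun j => by
    obtain rfl := Subsingleton.elim j 0
    rfl
  add f g := fun i => (f i).sum (g i)
  zero _ p := fun _ => (SyncTree.zero Sg p).cls
  add_assoc f g h := funext fun i => (f i).sum_assoc (g i) (h i)
  add_comm f g := funext fun i => (f i).sum_comm (g i)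
  zero_add f := funext fun i => (f i).zero_sum
  inj_add i f g := funext fun _ => by
    simp only [SimClass.exit_comp]
  inj_zero i := funext fun _ => SimClass.exit_comp i _
  add_comp f g h := funext fun i => (f i).sum_comp (g i) h
  zero_comp h := funext fun _ => SimClass.zero_comp h
  add_self f := funext fun i => (f i).sum_self

theorem SST.pair_one (Sg : ℕ → Type u) {n p : ℕ} (x : (SST Sg).Hom n p) :
    (SST Sg).pair x ((SST Sg).one p) = SimClass.withExits x := by
  funext m
  refine Fin.addCases (fun i => ?_) (fun i => ?_) m
  · have h := congrFun ((SST Sg).inj_pair_left x ((SST Sg).one p) i) 0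
    refine (SimClass.exit_comp _ _).symm.trans (h.trans ((SimClass.exit_comp i x).trans ?_))
    exact (SimClass.withExits_left x i).symm
  · have h := congrFun ((SST Sg).inj_pair_right x ((SST Sg).one p) i) 0
    refine (SimClass.exit_comp _ _).symm.trans (h.trans ((SimClass.exit_comp i _).trans ?_))
    exact (SimClass.withExits_right x i).symm

theorem SST.exists_isLeast (Sg : ℕ → Type u) {n p : ℕ} (f : (SST Sg).Hom n (n + p)) :
    ∃ x, IsLeast ((SST Sg).fixedPoints f) x ∧
      ((∀ i, (f i).IsRegular) → ∀ i, (x i).IsRegular) := by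
  obtain ⟨x, h1, h2, h3⟩ := SimClass.exists_least f
  have h : ∀ y : (SST Sg).Hom n p, y ∈ (SST Sg).fixedPoints f ↔
      ∀ i, y i = (f i).comp (SimClass.withExits y) := by
    intro y
    change y = _ ↔ _
    rw [SST.pair_one]
    exact funext_iff
  exact ⟨x, ⟨(h x).2 h1, fun y hy => funext (h2 y ((h y).1 hy))⟩, h3⟩

theorem SST.dagger_isLeast (Sg : ℕ → Type u) {n p : ℕ} (f : (SST Sg).Hom n (n + p)) :
    IsLeast ((SST Sg).fixedPoints f) ((SST Sg).dagger f) := by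
  obtain ⟨x, hx, -⟩ := SST.exists_isLeast Sg f
  rwa [(SST Sg).dagger_eq hx]

theorem SST.dagger_isRegular (Sg : ℕ → Type u) {n p : ℕ} (f : (SST Sg).Hom n (n + p))
    (hf : ∀ i, (f i).IsRegular) (i : Fin n) : ((SST Sg).dagger f i).IsRegular := by
  obtain ⟨x, hx, h⟩ := SST.exists_isLeast Sg f
  rw [(SST Sg).dagger_eq hx]
  exact h hf i

/-- The subtheory of `SST Sg` of the simulation equivalence classes that contain a regular
synchronization tree. -/
noncomputable def SRST (Sg : ℕ → Type u) : IdemGroveTheory.{max 1 u} where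
  Hom n p := {f : (SST Sg).Hom n p // ∀ i : Fin n, SimClass.IsRegular (f i)}
  comp f g := ⟨(SST Sg).comp f.1 g.1, fun i => (f.2 i).comp g.2⟩
  one n := ⟨(SST Sg).one n, SimClass.isRegular_exit⟩
  inj i := ⟨(SST Sg).inj i, fun _ => SimClass.isRegular_exit i⟩
  tup f := ⟨(SST Sg).tup fun i => (f i).1, fun i => (f i).2 0⟩
  comp_assoc f g h := Subtype.ext ((SST Sg).comp_assoc f.1 g.1 h.1)
  one_comp f := Subtype.ext ((SST Sg).one_comp f.1)
  comp_one f := Subtype.ext ((SST Sg).comp_one f.1)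
  inj_tup f i := Subtype.ext ((SST Sg).inj_tup (fun i => (f i).1) i)
  tup_inj f := Subtype.ext ((SST Sg).tup_inj f.1)
  one_one := Subtype.ext (SST Sg).one_one
  add f g := ⟨(SST Sg).add f.1 g.1, fun i => (f.2 i).sum (g.2 i)⟩
  zero n p := ⟨(SST Sg).zero n p, fun _ => SimClass.isRegular_zero⟩
  add_assoc f g h := Subtype.ext ((SST Sg).add_assoc f.1 g.1 h.1)
  add_comm f g := Subtype.ext ((SST Sg).add_comm f.1 g.1)
  zero_add f := Subtype.ext ((SST Sg).zero_add f.1)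
  inj_add i f g := Subtype.ext ((SST Sg).inj_add i f.1 g.1)
  inj_zero i := Subtype.ext ((SST Sg).inj_zero i)
  add_comp f g h := Subtype.ext ((SST Sg).add_comp f.1 g.1 h.1)
  zero_comp h := Subtype.ext ((SST Sg).zero_comp h.1)
  add_self f := Subtype.ext ((SST Sg).add_self f.1)

/-- The letter `σ` of rank `n`, as a morphism `1 → n` of `SRST Sg`. -/
noncomputable def SRST.letter {Sg : ℕ → Type u} {n : ℕ} (σ : Sg n) : (SRST Sg).Hom 1 n :=
  ⟨fun _ => (SyncTree.letter σ).cls, fun _ => SimClass.isRegular_letter σ⟩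

theorem SRST.coe_pair (Sg : ℕ → Type u) {n m p : ℕ} (f : (SRST Sg).Hom n p)
    (g : (SRST Sg).Hom m p) : ((SRST Sg).pair f g).1 = (SST Sg).pair f.1 g.1 := by
  refine (SST Sg).hom_ext fun i => ?_
  have h := congrArg Subtype.val ((SRST Sg).inj_tup
    (Fin.append (fun i => (SRST Sg).comp ((SRST Sg).inj i) f)
      (fun j => (SRST Sg).comp ((SRST Sg).inj j) g)) i)
  refine h.trans ?_
  refine Fin.addCases (fun i => ?_) (fun i => ?_) i
  · rw [Fin.append_left, IdemGroveTheory.inj_pair_left]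
    rfl
  · rw [Fin.append_right, IdemGroveTheory.inj_pair_right]
    rfl

theorem SRST.mem_fixedPoints (Sg : ℕ → Type u) {n p : ℕ} (f : (SRST Sg).Hom n (n + p))
    (x : (SRST Sg).Hom n p) :
    x ∈ (SRST Sg).fixedPoints f ↔ x.1 ∈ (SST Sg).fixedPoints f.1 := by
  have h : ((SRST Sg).comp f ((SRST Sg).pair x ((SRST Sg).one p))).1 =
      (SST Sg).comp f.1 ((SST Sg).pair x.1 ((SST Sg).one p)) :=
    congrArg ((SST Sg).comp f.1) (SRST.coe_pair Sg x ((SRST Sg).one p))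
  exact Subtype.ext_iff.trans (by rw [h]; rfl)

/-- `SRST Sg` is closed under the dagger operation of `SST Sg`, which gives the least solutions
of fixed point equations in `SRST Sg`. -/
theorem SRST.isLeast (Sg : ℕ → Type u) {n p : ℕ} (f : (SRST Sg).Hom n (n + p)) :
    IsLeast ((SRST Sg).fixedPoints f)
      ⟨(SST Sg).dagger f.1, SST.dagger_isRegular Sg f.1 f.2⟩ := by
  have h := SST.dagger_isLeast Sg f.1
  exact ⟨(SRST.mem_fixedPoints Sg f _).2 h.1,
    fun y hy => Subtype.ext (h.2 ((SRST.mem_fixedPoints Sg f y).1 hy))⟩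

theorem SRST.dagger_isLeast (Sg : ℕ → Type u) {n p : ℕ} (f : (SRST Sg).Hom n (n + p)) :
    IsLeast ((SRST Sg).fixedPoints f) ((SRST Sg).dagger f) := by
  rw [(SRST Sg).dagger_eq (SRST.isLeast Sg f)]
  exact SRST.isLeast Sg f

/-- The dagger operation of `SRST Sg` is the restriction of that of `SST Sg`. -/
theorem SRST.coe_dagger (Sg : ℕ → Type u) {n p : ℕ} (f : (SRST Sg).Hom n (n + p)) :
    ((SRST Sg).dagger f).1 = (SST Sg).dagger f.1 := by
  rw [(SRST Sg).dagger_eq (SRST.isLeast Sg f)]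

end Grove

/-!
The morphism is constructed by interpreting each vertex of a graph as a morphism `1 → p` of `T`.
An edge `v → (v_1, …, v_k)` labeled by a letter `σ` is read as the inequation
`φ(σ) · ⟨x_{v_1}, …, x_{v_k}⟩ ≤ x_v`, and one labeled by `ex_i` as `i_p ≤ x_v`. In the order of an
`ω`-continuous idempotent grove theory, `+` is the binary join, so that countable joins exist and
are preserved by composition on the right. Hence the system of these inequations has a least
solution, the least model `interp` of the graph (`IsOmegaContinuous.exists_interp`), which is the
supremum of an `ω`-chain of approximations. It comes with an induction principle
(`interp_comp_le`) that bounds the components of the least model, possibly composed with a further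
morphism on the right. No finiteness is needed up to this point.

By this principle the least model is monotone along simulations (`interp_le_of_sim`), and therefore
defined on simulation equivalence classes. It commutes with the sum (`interp_sumGraph`) and with
composition (`interp_compGraph`), which uses that composition on the right preserves the joins.
This gives the morphism `lift`. It maps `f†` to a solution of the interpreted system. Since `f†` is
represented by `daggerGraph`, of which each solution of the interpreted system yields a model
(`interp_daggerGraph_le`), the image is the least solution (`lift_preservesDagger`).

For uniqueness, a class that contains a regular tree comes from a finite graph. In `SRST` itself, the
classes of the trees at the vertices of a finite graph form the least model of the graph
(`SRST.vertexClass_isModel`, `SRST.vertexClass_le_of_isModel`), and satisfy its equations, so they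
are the dagger of a morphism `system` that is built from letters by the operations that a morphism
preserves (`dagger_system`). Thus a morphism that preserves dagger is determined by its values
on the letters (`Morphism.ext_of_letter`).
-/

namespace Grove

namespace IdemGroveTheory

/-! ### Joins in an idempotent grove theory -/

section Order

variable (T : IdemGroveTheory.{v}) {n p q : ℕ}

theorem le_add_left (f g : T.Hom n p) : f ≤ T.add f g := by
  change T.add f (T.add f g) = T.add f g
  rw [← T.add_assoc, T.add_self]

theorem le_add_right (f g : T.Hom n p) : g ≤ T.add f g := by
  rw [T.add_comm]
  exact T.le_add_left g f

theorem add_le {f g h : T.Hom n p} (hf : f ≤ h) (hg : g ≤ h) : T.add f g ≤ h := by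
  change T.add (T.add f g) h = h
  rw [T.add_assoc, show T.add g h = h from hg]
  exact hf

theorem comp_mono_left {f f' : T.Hom n p} (h : f ≤ f') (g : T.Hom p q) :
    T.comp f g ≤ T.comp f' g := by
  change T.add _ _ = _
  rw [← T.add_comp]
  exact congrArg (fun k => T.comp k g) h

theorem tup_mono {f g : Fin n → T.Hom 1 p} (h : ∀ i, f i ≤ g i) : T.tup f ≤ T.tup g :=
  T.le_of_inj fun i => by
    rw [T.inj_tup, T.inj_tup]
    exact h i

theorem tup_comp (f : Fin n → T.Hom 1 p) (g : T.Hom p q) :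
    T.comp (T.tup f) g = T.tup fun i => T.comp (f i) g :=
  T.hom_ext fun i => by rw [← T.comp_assoc, T.inj_tup, T.inj_tup]

theorem tup_of_inj : T.tup (fun i : Fin n => T.inj i) = T.one n :=
  T.hom_ext fun i => by rw [T.inj_tup, T.comp_one]

theorem inj_zero_comp (f : T.Hom 1 p) : T.comp (T.inj 0) f = f := by
  rw [← T.one_one, T.one_comp]

theorem isLUB_tup {f : ℕ → Fin n → T.Hom 1 p} {s : Fin n → T.Hom 1 p}
    (h : ∀ i, IsLUB (Set.range fun k => f k i) (s i)) :
    IsLUB (Set.range fun k => T.tup (f k)) (T.tup s) := by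
  constructor
  · rintro _ ⟨k, rfl⟩
    exact T.tup_mono fun i => (h i).1 ⟨k, rfl⟩
  · intro b hb
    refine T.le_of_inj fun i => ?_
    rw [T.inj_tup]
    refine (h i).2 ?_
    rintro _ ⟨k, rfl⟩
    have := T.inj_comp_mono (hb ⟨k, rfl⟩) i
    rwa [T.inj_tup] at this

/-- The sum of a list of morphisms. -/
def listSum (l : List (T.Hom n p)) : T.Hom n p :=
  l.foldr T.add (T.zero n p)

theorem listSum_le_iff {l : List (T.Hom n p)} {b : T.Hom n p} :
    T.listSum l ≤ b ↔ ∀ f ∈ l, f ≤ b := by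
  induction l with
  | nil => exact ⟨fun _ _ h => by simp at h, fun _ => T.zero_le b⟩
  | cons a l ih =>
    rw [List.forall_mem_cons, ← ih]
    exact ⟨fun h => ⟨(T.le_add_left _ _).trans h, (T.le_add_right _ _).trans h⟩,
      fun h => T.add_le h.1 h.2⟩

theorem listSum_comp (l : List (T.Hom n p)) (g : T.Hom p q) :
    T.comp (T.listSum l) g = T.listSum (l.map fun f => T.comp f g) := by
  induction l with
  | nil => exact T.zero_comp g
  | cons a l ih => exact (T.add_comp _ _ _).trans (congrArg _ ih)

variable {T}

/-- In an `ω`-continuous idempotent grove theory, countable sets of morphisms have joins, namely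
the suprema of the chains of their finite partial sums, and composition in the first argument
preserves these joins. The case `h = 1_p` says that `s` is the join. -/
theorem IsOmegaContinuous.exists_join (hT : T.IsOmegaContinuous) {S : Set (T.Hom n p)}
    (hS : S.Countable) :
    ∃ s, ∀ (q : ℕ) (h : T.Hom p q) (b : T.Hom n q),
      T.comp s h ≤ b ↔ ∀ f ∈ S, T.comp f h ≤ b := by
  rcases S.eq_empty_or_nonempty with rfl | hne
  · refine ⟨T.zero n p, fun q h b => ⟨fun _ f hf => hf.elim, fun _ => ?_⟩⟩
    rw [T.zero_comp]
    exact T.zero_le b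
  obtain ⟨f, rfl⟩ := hS.exists_eq_range hne
  let g : ℕ → T.Hom n p := fun k => Nat.rec (f 0) (fun k x => T.add x (f (k + 1))) k
  have hg : Monotone g := monotone_nat_of_le_succ fun k => T.le_add_left _ _
  have hfg : ∀ k, f k ≤ g k := by
    intro k
    cases k with
    | zero => exact le_rfl
    | succ k => exact T.le_add_right _ _
  obtain ⟨s, hs⟩ := hT.exists_sup g hg
  refine ⟨s, fun q h b => ?_⟩
  have hsh := hT.sup_comp g s h hg hs
  constructor
  · rintro hb _ ⟨k, rfl⟩
    exact (T.comp_mono_left ((hfg k).trans (hs.1 ⟨k, rfl⟩)) h).trans hb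
  · intro hb
    refine hsh.2 ?_
    rintro _ ⟨k, rfl⟩
    induction k with
    | zero => exact hb _ ⟨0, rfl⟩
    | succ k ih =>
      change T.comp (T.add (g k) (f (k + 1))) h ≤ b
      rw [T.add_comp]
      exact T.add_le ih (hb _ ⟨k + 1, rfl⟩)

end Order

/-! ### Interpretation of graphs -/

section Interp

variable {Sg : ℕ → Type u} (T : IdemGroveTheory.{v}) (φ : ∀ n : ℕ, Sg n → T.Hom 1 n) {p q : ℕ}

/-- The value of an edge with a given label whose targets have the values `l`: it is
`φ(σ) · ⟨l⟩` for a letter `σ`, and `i_p` for the exit symbol `ex_i`. The list `l` is padded by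
zeros, but is only ever used with a length that is the rank of the label. -/
def ev : Label Sg p → List (T.Hom 1 p) → T.Hom 1 p
  | .letter σ, l => T.comp (φ σ.1 σ.2) (T.tup fun i => l.getD i (T.zero 1 p))
  | .exit i, _ => T.inj i

/-- A family of morphisms indexed by the vertices of a graph is a model if it satisfies the
inequations given by the edges. -/
def IsModel (G : SyncGraph Sg p) (x : G.V → T.Hom 1 p) : Prop :=
  ∀ v a ws, G.Step v a ws → T.ev φ a (ws.map x) ≤ x v

theorem ev_letter_comp (σ : Σ n, Sg n) (l : List (T.Hom 1 p)) (h : T.Hom p q) :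
    T.comp (T.ev φ (.letter σ) l) h = T.ev φ (.letter σ) (l.map fun f => T.comp f h) := by
  rw [ev, ev, T.comp_assoc, tup_comp]
  refine congrArg (fun k => T.comp _ (T.tup k)) (funext fun i => ?_)
  rw [← T.zero_comp (n := 1) h]
  exact (List.getD_map (f := fun f => T.comp f h) ..).symm

/-- An edge that is labeled by a letter or by one of the last `p` exit symbols keeps its label
when `⟨x, 1_p⟩` is substituted for the exit symbols: the substitution acts on its targets only. -/
theorem ev_shift_comp {n : ℕ} (a : Label Sg p) (l : List (T.Hom 1 (n + p))) (x : T.Hom n p) :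
    T.comp (T.ev φ (a.shift n) l) (T.pair x (T.one p)) =
      T.ev φ a (l.map fun f => T.comp f (T.pair x (T.one p))) := by
  cases a with
  | letter σ => exact T.ev_letter_comp φ σ l _
  | exit i => exact (T.inj_pair_right _ _ _).trans (T.comp_one _)

variable {T} {φ}

theorem IsOmegaContinuous.ev_mono (hT : T.IsOmegaContinuous) (a : Label Sg p)
    {l m : List (T.Hom 1 p)} (h : List.Forall₂ (· ≤ ·) l m) : T.ev φ a l ≤ T.ev φ a m := by
  cases a with
  | exit i => exact le_rfl
  | letter σ =>
    refine hT.comp_mono _ (T.tup_mono fun i => ?_)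
    generalize (i : ℕ) = k
    induction h generalizing k with
    | nil => exact le_rfl
    | cons h _ ih =>
      cases k with
      | zero => exact h
      | succ k => simpa using ih k

theorem IsOmegaContinuous.ev_map_mono (hT : T.IsOmegaContinuous) {α : Type*} (a : Label Sg p)
    (ws : List α) {x y : α → T.Hom 1 p} (h : ∀ w, x w ≤ y w) :
    T.ev φ a (ws.map x) ≤ T.ev φ a (ws.map y) :=
  hT.ev_mono a (SyncGraph.forall₂_map_both (R := Eq) (by rintro w _ rfl; exact h w)
    (List.forall₂_same.2 fun _ _ => rfl))

theorem IsOmegaContinuous.ev_sup (hT : T.IsOmegaContinuous) {α : Type*} (a : Label Sg p)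
    (ws : List α) {x : ℕ → α → T.Hom 1 p} {s : α → T.Hom 1 p} (hx : Monotone x)
    (hs : ∀ w, IsLUB (Set.range fun k => x k w) (s w)) :
    IsLUB (Set.range fun k => T.ev φ a (ws.map (x k))) (T.ev φ a (ws.map s)) := by
  have hconst : ∀ {r : ℕ} (f : T.Hom r p), IsLUB (Set.range fun _ : ℕ => f) f := by
    intro r f
    rw [Set.range_const]
    exact isLUB_singleton
  cases a with
  | exit i => exact hconst _
  | letter σ =>
    refine hT.comp_sup _ _ _ (fun k l hkl => T.tup_mono fun i => ?_) (T.isLUB_tup fun i => ?_)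
    · simp only [List.getD_eq_getElem?_getD, List.getElem?_map]
      cases ws[(i : ℕ)]? with
      | none => exact le_rfl
      | some w => exact hx hkl w
    · simp only [List.getD_eq_getElem?_getD, List.getElem?_map]
      cases ws[(i : ℕ)]? with
      | none => exact hconst _
      | some w => exact hs w

/-- The values of the edges at a vertex have a join, which is preserved by composition. -/
theorem IsOmegaContinuous.exists_step_join (hT : T.IsOmegaContinuous) (G : SyncGraph Sg p)
    (y : G.V → T.Hom 1 p) (v : G.V) :
    ∃ s, (∀ b, s ≤ b ↔ ∀ a ws, G.Step v a ws → T.ev φ a (ws.map y) ≤ b) ∧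
      ∀ (q : ℕ) (h : T.Hom p q) (b : T.Hom 1 q),
        T.comp s h ≤ b ↔ ∀ a ws, G.Step v a ws → T.comp (T.ev φ a (ws.map y)) h ≤ b := by
  have hc : {f | ∃ a ws, G.Step v a ws ∧ T.ev φ a (ws.map y) = f}.Countable := by
    have := G.countable_E
    refine (Set.countable_range fun e => T.ev φ (G.lab e) ((G.tgt e).map y)).mono ?_
    rintro _ ⟨_, _, ⟨e, -, rfl, rfl⟩, rfl⟩
    exact ⟨e, rfl⟩
  obtain ⟨s, hs⟩ := hT.exists_join hc
  have hs' : ∀ (q : ℕ) (h : T.Hom p q) (b : T.Hom 1 q),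
      T.comp s h ≤ b ↔ ∀ a ws, G.Step v a ws → T.comp (T.ev φ a (ws.map y)) h ≤ b := by
    intro q h b
    rw [hs]
    exact ⟨fun H a ws hstep => H _ ⟨a, ws, hstep, rfl⟩,
      fun H f ⟨a, ws, hstep, hf⟩ => hf ▸ H a ws hstep⟩
  refine ⟨s, fun b => ?_, hs'⟩
  simpa only [T.comp_one] using hs' p (T.one p) b

/-- Every graph has a least model. The second property is the induction principle for its
construction by iteration: it bounds the components of the least model, composed with some `h`,
by the elements of the sets `B v`, provided that the bounds are preserved by the edges. -/
theorem IsOmegaContinuous.exists_interp (hT : T.IsOmegaContinuous)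
    (φ : ∀ n : ℕ, Sg n → T.Hom 1 n) (G : SyncGraph Sg p) :
    ∃ x : G.V → T.Hom 1 p, T.IsModel φ G x ∧
      ∀ (q : ℕ) (h : T.Hom p q) (B : G.V → Set (T.Hom 1 q)),
        (∀ y : G.V → T.Hom 1 p, (∀ v, ∀ b ∈ B v, T.comp (y v) h ≤ b) →
          ∀ v a ws, G.Step v a ws → ∀ b ∈ B v, T.comp (T.ev φ a (ws.map y)) h ≤ b) →
        ∀ v, ∀ b ∈ B v, T.comp (x v) h ≤ b := by
  choose Φ hΦ1 hΦ using hT.exists_step_join (φ := φ) G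
  have hmono : Monotone Φ := fun y z hyz v => (hΦ1 y v _).2 fun a ws hs =>
    (hT.ev_map_mono a ws hyz).trans ((hΦ1 z v _).1 le_rfl a ws hs)
  let x : ℕ → G.V → T.Hom 1 p := fun k => Φ^[k] fun _ => T.zero 1 p
  have hx1 : ∀ k, x (k + 1) = Φ (x k) := fun k => Function.iterate_succ_apply' Φ k _
  have hx : Monotone x := by
    refine monotone_nat_of_le_succ fun k => ?_
    induction k with
    | zero => exact fun v => T.zero_le _
    | succ k ih =>
      rw [hx1 k, hx1 (k + 1)]
      exact hmono ih
  choose s hs using fun v => hT.exists_sup (fun k => x k v) fun _ _ h => hx h v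
  refine ⟨s, fun v a ws hstep => (hT.ev_sup a ws hx hs).2 ?_, fun q h B hB v b hb => ?_⟩
  · rintro _ ⟨k, rfl⟩
    refine ((hΦ1 _ _ _).1 le_rfl a ws hstep).trans ?_
    rw [← hx1]
    exact (hs v).1 ⟨k + 1, rfl⟩
  · refine (hT.sup_comp _ _ h (fun _ _ h => hx h v) (hs v)).2 ?_
    rintro _ ⟨k, rfl⟩
    induction k generalizing v b with
    | zero =>
      change T.comp (T.zero 1 p) h ≤ b
      rw [T.zero_comp]
      exact T.zero_le b
    | succ k ih =>
      change T.comp (x (k + 1) v) h ≤ b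
      rw [hx1, hΦ]
      intro a ws hstep
      exact hB (x k) ih v a ws hstep b hb

/-- The least model of a graph: the value of a vertex is the interpretation in `T` of the tree
obtained by unfolding the graph from this vertex. -/
noncomputable def interp (hT : T.IsOmegaContinuous) (φ : ∀ n : ℕ, Sg n → T.Hom 1 n)
    (G : SyncGraph Sg p) : G.V → T.Hom 1 p :=
  (hT.exists_interp φ G).choose

variable (hT : T.IsOmegaContinuous)

theorem interp_isModel (G : SyncGraph Sg p) : T.IsModel φ G (interp hT φ G) :=
  (hT.exists_interp φ G).choose_spec.1

theorem interp_comp_le {G : SyncGraph Sg p} {h : T.Hom p q} {B : G.V → Set (T.Hom 1 q)}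
    (hB : ∀ y : G.V → T.Hom 1 p, (∀ v, ∀ b ∈ B v, T.comp (y v) h ≤ b) →
      ∀ v a ws, G.Step v a ws → ∀ b ∈ B v, T.comp (T.ev φ a (ws.map y)) h ≤ b)
    {v : G.V} {b : T.Hom 1 q} (hb : b ∈ B v) : T.comp (interp hT φ G v) h ≤ b :=
  (hT.exists_interp φ G).choose_spec.2 q h B hB v b hb

theorem interp_le_of_isModel {G : SyncGraph Sg p} {x : G.V → T.Hom 1 p} (hx : T.IsModel φ G x)
    (v : G.V) : interp hT φ G v ≤ x v := by
  have h := interp_comp_le hT (φ := φ) (G := G) (h := T.one p) (B := fun v => {x v}) ?_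
    (Set.mem_singleton (x v))
  · rwa [T.comp_one] at h
  · rintro y hy v a ws hs _ rfl
    rw [T.comp_one]
    refine (hT.ev_map_mono a ws fun w => ?_).trans (hx v a ws hs)
    have := hy w _ rfl
    rwa [T.comp_one] at this

/-- The least model satisfies the equations of the graph. -/
theorem interp_le_of_step {G : SyncGraph Sg p} {v : G.V} {b : T.Hom 1 p}
    (h : ∀ a ws, G.Step v a ws → T.ev φ a (ws.map (interp hT φ G)) ≤ b) :
    interp hT φ G v ≤ b := by
  classical
  -- Otherwise a join of the values of the edges at `v` would give a smaller model.
  obtain ⟨s, hs1, -⟩ := hT.exists_step_join (φ := φ) G (interp hT φ G) v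
  have hle : ∀ w, Function.update (interp hT φ G) v s w ≤ interp hT φ G w := by
    intro w
    by_cases hw : w = v
    · subst hw
      rw [Function.update_self]
      exact (hs1 _).2 fun a ws hstep => interp_isModel hT G w a ws hstep
    · rw [Function.update_of_ne hw]
  have key := interp_le_of_isModel hT (φ := φ) (G := G) (x := Function.update (interp hT φ G) v s)
    (fun w a ws hstep => by
      refine (hT.ev_map_mono a ws hle).trans ?_
      by_cases hw : w = v
      · subst hw
        rw [Function.update_self]
        exact (hs1 s).1 le_rfl a ws hstep
      · rw [Function.update_of_ne hw]
        exact interp_isModel hT G w a ws hstep) v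
  rw [Function.update_self] at key
  exact key.trans ((hs1 b).2 h)

/-- The interpretation is monotone with respect to simulation. -/
theorem interp_le_of_sim {G H : SyncGraph Sg p} {v : G.V} {w : H.V}
    (h : SyncGraph.Sim G H v w) : interp hT φ G v ≤ interp hT φ H w := by
  have key := interp_comp_le hT (φ := φ) (G := G) (h := T.one p)
    (B := fun v => {b | ∃ w, SyncGraph.Sim G H v w ∧ b = interp hT φ H w}) ?_
    (v := v) ⟨w, h, rfl⟩
  · rwa [T.comp_one] at key
  · rintro y hy v a ws hs _ ⟨w, hvw, rfl⟩
    rw [T.comp_one]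
    obtain ⟨ws', h1, h2⟩ := SyncGraph.localSim_sim _ _ _ _ hvw _ _ hs
    refine (hT.ev_mono a (SyncGraph.forall₂_map_both (fun u u' hu => ?_) h2)).trans
      (interp_isModel hT H _ _ _ h1)
    have := hy u _ ⟨u', hu, rfl⟩
    rwa [T.comp_one] at this

end Interp

end IdemGroveTheory

namespace SyncGraph

variable {Sg : ℕ → Type u} {n p : ℕ}

theorem letter_step_none {σ : Sg n} {a : Label Sg n} {ws : List (letterGraph σ).V} :
    (letterGraph σ).Step none a ws ↔ a = .letter ⟨n, σ⟩ ∧ ws = (List.finRange n).map some := by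
  constructor
  · rintro ⟨e, h, rfl, rfl⟩
    cases h
    exact ⟨rfl, rfl⟩
  · rintro ⟨rfl, rfl⟩
    exact ⟨none, rfl, rfl, rfl⟩

theorem letter_step_some {σ : Sg n} {i : Fin n} {a : Label Sg n} {ws : List (letterGraph σ).V} :
    (letterGraph σ).Step (some i) a ws ↔ a = .exit i ∧ ws = [] := by
  constructor
  · rintro ⟨e, h, rfl, rfl⟩
    cases h
    exact ⟨rfl, rfl⟩
  · rintro ⟨rfl, rfl⟩
    exact ⟨some i, rfl, rfl, rfl⟩

end SyncGraph

namespace IdemGroveTheory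

open SyncGraph

/-! ### Interpretation and the operations on graphs -/

section Operations

variable {Sg : ℕ → Type u} {T : IdemGroveTheory.{v}} (hT : T.IsOmegaContinuous)
  {φ : ∀ n : ℕ, Sg n → T.Hom 1 n} {n p q : ℕ}

theorem interp_zeroGraph (v : (zeroGraph Sg p).V) :
    interp hT φ (zeroGraph Sg p) v = T.zero 1 p :=
  le_antisymm (interp_le_of_step hT fun _ _ hs => (zero_step hs).elim) (T.zero_le _)

theorem interp_exitGraph (i : Fin p) (v : (exitGraph Sg i).V) :
    interp hT φ (exitGraph Sg i) v = T.inj i := by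
  refine le_antisymm (interp_le_of_step hT fun a ws hs => ?_)
    (interp_isModel hT (exitGraph Sg i) v _ _ (exit_step.2 ⟨rfl, rfl⟩))
  obtain ⟨rfl, rfl⟩ := exit_step.1 hs
  exact le_rfl

theorem interp_letterGraph (σ : Sg n) :
    interp hT φ (letterGraph σ) (letterGraph σ).root = φ n σ := by
  have hsome : ∀ i : Fin n, interp hT φ (letterGraph σ) (some i) = T.inj i := by
    intro i
    refine le_antisymm (interp_le_of_step hT fun a ws hs => ?_)
      (interp_isModel hT (letterGraph σ) (some i) _ _ (letter_step_some.2 ⟨rfl, rfl⟩))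
    obtain ⟨rfl, rfl⟩ := letter_step_some.1 hs
    exact le_rfl
  have hev : T.ev φ (.letter ⟨n, σ⟩) (((List.finRange n).map some).map
      (interp hT φ (letterGraph σ))) = φ n σ := by
    refine Eq.trans ?_ (T.comp_one (φ n σ))
    rw [← T.tup_of_inj]
    have hl : ((List.finRange n).map some).map (interp hT φ (letterGraph σ)) =
        (List.finRange n).map fun i => T.inj i :=
      List.map_map.trans (List.map_congr_left fun i _ => hsome i)
    rw [hl]
    refine congrArg (fun k => T.comp _ (T.tup k)) (funext fun i : Fin n => ?_)
    simp [List.getD_eq_getElem?_getD]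
  refine le_antisymm (interp_le_of_step hT fun a ws hs => ?_) ?_
  · obtain ⟨rfl, rfl⟩ := letter_step_none.1 hs
    exact hev.le
  · exact hev.ge.trans (interp_isModel hT (letterGraph σ) none _ _ (letter_step_none.2 ⟨rfl, rfl⟩))

theorem interp_sumGraph (G H : SyncGraph Sg p) :
    interp hT φ (sumGraph G H) (sumGraph G H).root =
      T.add (interp hT φ G G.root) (interp hT φ H H.root) := by
  refine le_antisymm (interp_le_of_step hT fun a ws hs => ?_)
    (T.add_le (interp_le_of_sim hT (simLE_iff.1 (le_sum_left G H)))
      (interp_le_of_sim hT (simLE_iff.1 (le_sum_right G H))))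
  obtain ⟨us, h, rfl⟩ | ⟨us, h, rfl⟩ := sum_step_none.1 hs
  · rw [List.map_map]
    exact ((hT.ev_map_mono a us fun w => interp_le_of_sim hT (sum_inl_sim G H w)).trans
      (interp_isModel hT G _ _ _ h)).trans (T.le_add_left _ _)
  · rw [List.map_map]
    exact ((hT.ev_map_mono a us fun w => interp_le_of_sim hT (sum_inr_sim G H w)).trans
      (interp_isModel hT H _ _ _ h)).trans (T.le_add_right _ _)

theorem interp_compGraph_inr (G : SyncGraph Sg p) (H : Fin p → SyncGraph Sg q) (i : Fin p)
    (v : (H i).V) :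
    interp hT φ (compGraph G H) (compR G H i v) = interp hT φ (H i) v :=
  le_antisymm (interp_le_of_sim hT (comp_inr_sim G H i v))
    (interp_le_of_sim hT (sim_comp_inr G H i v))

theorem interp_compGraph (G : SyncGraph Sg p) (H : Fin p → SyncGraph Sg q) (v : G.V) :
    interp hT φ (compGraph G H) (compL G H v) =
      T.comp (interp hT φ G v) (T.tup fun i => interp hT φ (H i) (H i).root) := by
  apply le_antisymm
  · refine interp_le_of_isModel hT (x := fun w : (compGraph G H).V => Sum.elim
      (fun v => T.comp (interp hT φ G v) (T.tup fun i => interp hT φ (H i) (H i).root))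
      (fun z => interp hT φ (H z.1) z.2) w) ?_ (compL G H v)
    rintro (v | ⟨i, w⟩) a ws hs
    · obtain ⟨σ, us, h, rfl, rfl⟩ | ⟨i, us, h1, h2, rfl⟩ := comp_step_inl.1 hs
      · have h3 := T.comp_mono_left (interp_isModel hT (φ := φ) G _ _ _ h)
          (T.tup fun i => interp hT φ (H i) (H i).root)
        rw [ev_letter_comp, List.map_map] at h3
        rw [List.map_map]
        exact h3
      · have h3 := T.comp_mono_left (interp_isModel hT (φ := φ) G _ _ _ h1)
          (T.tup fun i => interp hT φ (H i) (H i).root)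
        rw [ev, T.inj_tup] at h3
        rw [List.map_map]
        exact (interp_isModel hT (H i) _ _ _ h2).trans h3
    · obtain ⟨us, h, rfl⟩ := comp_step_inr.1 hs
      rw [List.map_map]
      exact interp_isModel hT (H i) _ _ _ h
  · refine interp_comp_le hT (B := fun v => {interp hT φ (compGraph G H) (compL G H v)}) ?_
      (Set.mem_singleton _)
    rintro y hy v a ws hs _ rfl
    cases a with
    | letter σ =>
      rw [ev_letter_comp, List.map_map]
      refine (hT.ev_map_mono _ ws fun w => hy w _ rfl).trans ?_
      have h := interp_isModel hT (φ := φ) (compGraph G H) (compL G H v) (.letter σ) _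
        (comp_step_inl.2 (Or.inl ⟨σ, ws, hs, rfl, rfl⟩))
      rwa [List.map_map] at h
    | exit i =>
      obtain rfl := hs.exit_nil
      rw [ev, T.inj_tup]
      refine interp_le_of_step hT fun a us h => ?_
      have h := interp_isModel hT (φ := φ) (compGraph G H) (compL G H v) a _
        (comp_step_inl.2 (Or.inr ⟨i, us, hs, h, rfl⟩))
      rw [List.map_map] at h
      refine (hT.ev_map_mono a us fun w => ?_).trans h
      exact (interp_compGraph_inr hT G H i w).ge

/-- If `y` solves the interpretation of the system `x_i = F_i · ⟨x, 1_p⟩`, then the interpretation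
of `daggerGraph F`, which solves the system itself, is below `y`: composing the least models
of the graphs `F i` with `⟨y, 1_p⟩` gives a model of `daggerGraph F k`. -/
theorem interp_daggerGraph_le (F : Fin n → SyncGraph Sg (n + p)) {y : T.Hom n p}
    (hy : ∀ i, T.comp (T.inj i) y =
      T.comp (interp hT φ (F i) (F i).root) (T.pair y (T.one p))) (k : Fin n) :
    interp hT φ (daggerGraph F k) (daggerGraph F k).root ≤ T.comp (T.inj k) y := by
  let z : (Σ i, (F i).V) → T.Hom 1 p := fun w =>
    T.comp (interp hT φ (F w.1) w.2) (T.pair y (T.one p))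
  have hjump : ∀ w w', Jump F w w' → z w' ≤ z w := by
    intro w w' h
    induction h with
    | refl w => exact le_rfl
    | @head i v j w' h _ ih =>
      refine ih.trans ?_
      have h1 := T.comp_mono_left (interp_isModel hT (φ := φ) (F i) _ _ _ h)
        (T.pair y (T.one p))
      rw [ev, inj_pair_left, hy] at h1
      exact h1
  rw [hy]
  refine interp_le_of_isModel hT (G := daggerGraph F k) (x := z) ?_ (daggerGraph F k).root
  rintro ⟨i, v⟩ a ws hs
  obtain ⟨i', v', us, h1, h2, rfl⟩ := dagger_step.1 hs
  refine le_trans ?_ (hjump _ _ h1)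
  have h3 := T.comp_mono_left (interp_isModel hT (φ := φ) (F i') _ _ _ h2) (T.pair y (T.one p))
  rw [ev_shift_comp, List.map_map] at h3
  exact (congrArg (T.ev φ a) (List.map_map (f := daggerV F k i') (g := z))).trans_le h3

end Operations

/-! ### The morphism induced by an interpretation of the letters -/

section Lift

variable {Sg : ℕ → Type u} {T : IdemGroveTheory.{v}} (hT : T.IsOmegaContinuous)
  (φ : ∀ n : ℕ, Sg n → T.Hom 1 n) {n p q : ℕ}

/-- The interpretation of a simulation equivalence class of trees. -/
noncomputable def interpClass (x : SimClass Sg p) : T.Hom 1 p :=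
  interp hT φ x.rep.toSyncGraph x.rep.root

theorem interpClass_ofGraph (G : SyncGraph Sg p) :
    interpClass hT φ (SimClass.ofGraph G) = interp hT φ G G.root :=
  le_antisymm (interp_le_of_sim hT (simLE_iff.1 (SimClass.rep_ofGraph G).1))
    (interp_le_of_sim hT (simLE_iff.1 (SimClass.rep_ofGraph G).2))

theorem interpClass_exit (i : Fin p) : interpClass hT φ (SyncTree.exit Sg i).cls = T.inj i :=
  (interpClass_ofGraph hT φ (exitGraph Sg i)).trans (interp_exitGraph hT i _)

theorem interpClass_zero : interpClass hT φ (SyncTree.zero Sg p).cls = T.zero 1 p :=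
  (interpClass_ofGraph hT φ (zeroGraph Sg p)).trans (interp_zeroGraph hT _)

theorem interpClass_letter (σ : Sg n) : interpClass hT φ (SyncTree.letter σ).cls = φ n σ :=
  (interpClass_ofGraph hT φ (letterGraph σ)).trans (interp_letterGraph hT σ)

theorem interpClass_sum (x y : SimClass Sg p) :
    interpClass hT φ (x.sum y) = T.add (interpClass hT φ x) (interpClass hT φ y) := by
  obtain ⟨G, rfl⟩ := x.exists_graph
  obtain ⟨H, rfl⟩ := y.exists_graph
  simp only [SimClass.sum_ofGraph, interpClass_ofGraph]
  exact interp_sumGraph hT G H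

theorem interpClass_comp (x : SimClass Sg p) (y : Fin p → SimClass Sg q) :
    interpClass hT φ (x.comp y) =
      T.comp (interpClass hT φ x) (T.tup fun i => interpClass hT φ (y i)) := by
  obtain ⟨G, rfl⟩ := x.exists_graph
  choose H hH using fun i => (y i).exists_graph
  obtain rfl := funext hH
  simp only [SimClass.comp_ofGraph, interpClass_ofGraph]
  exact interp_compGraph hT G H G.root

/-- The interpretation of tuples of regular classes, as a morphism of theories. -/
noncomputable def lift : Morphism (SRST Sg) T where
  map f := T.tup fun i => interpClass hT φ (f.1 i)
  map_one n := by
    rw [← T.tup_of_inj]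
    exact congrArg T.tup (funext fun i => interpClass_exit hT φ i)
  map_comp f g := by
    rw [tup_comp]
    exact congrArg T.tup (funext fun i => interpClass_comp hT φ (f.1 i) g.1)
  map_inj i := by
    refine T.hom_ext fun j => ?_
    obtain rfl := Subsingleton.elim j 0
    rw [T.inj_tup, inj_zero_comp]
    exact interpClass_exit hT φ i
  map_add f g := by
    refine T.hom_ext fun i => ?_
    rw [T.inj_add, T.inj_tup, T.inj_tup, T.inj_tup]
    exact interpClass_sum hT φ _ _
  map_zero n p := by
    refine T.hom_ext fun i => ?_
    rw [T.inj_tup, T.inj_zero]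
    exact interpClass_zero hT φ

theorem lift_letter (σ : Sg n) : (lift hT φ).map (SRST.letter σ) = φ n σ :=
  (T.inj_zero_comp _).symm.trans
    ((T.inj_tup (n := 1) (fun _ => interpClass hT φ (SyncTree.letter σ).cls) 0).trans
      (interpClass_letter hT φ σ))

end Lift

namespace Morphism

variable {S : IdemGroveTheory.{v}} {T : IdemGroveTheory.{w}} (F : Morphism S T) {n m p : ℕ}

theorem map_tup (f : Fin n → S.Hom 1 p) : F.map (S.tup f) = T.tup fun i => F.map (f i) :=
  T.hom_ext fun i => by rw [T.inj_tup, ← F.map_inj, ← F.map_comp, S.inj_tup]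

theorem map_pair (f : S.Hom n p) (g : S.Hom m p) :
    F.map (S.pair f g) = T.pair (F.map f) (F.map g) := by
  refine T.hom_ext fun i => ?_
  rw [← F.map_inj, ← F.map_comp, F.map_inj]
  refine Fin.addCases (fun i => ?_) (fun i => ?_) i
  · rw [inj_pair_left, inj_pair_left, F.map_comp, F.map_inj]
  · rw [inj_pair_right, inj_pair_right, F.map_comp, F.map_inj]

theorem map_mem_fixedPoints {f : S.Hom n (n + p)} {x : S.Hom n p} (hx : x ∈ S.fixedPoints f) :
    F.map x ∈ T.fixedPoints (F.map f) := by
  have h : x = S.comp f (S.pair x (S.one p)) := hx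
  change F.map x = T.comp (F.map f) (T.pair (F.map x) (T.one p))
  rw [← F.map_one, ← map_pair, ← F.map_comp, ← h]

end Morphism

/-- The interpretation preserves dagger: `F(f†)` is a solution of the interpreted system, and
it is below every other solution. -/
theorem lift_preservesDagger {Sg : ℕ → Type u} {T : IdemGroveTheory.{v}}
    (hT : T.IsOmegaContinuous) (φ : ∀ n : ℕ, Sg n → T.Hom 1 n) :
    (lift hT φ).PreservesDagger := by
  intro n p f
  refine (T.dagger_eq ⟨(lift hT φ).map_mem_fixedPoints (SRST.dagger_isLeast Sg f).1,
    fun y hy => ?_⟩).symm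
  choose F h1 h2 h3 using fun i => SimClass.isRegular_iff.1 (f.2 i)
  -- The graphs of `daggerGraph` solve the system, and thus dominate its least solution.
  let X : (SST Sg).Hom n p := fun i => SimClass.ofGraph (daggerGraph F i)
  have hfix : X ∈ (SST Sg).fixedPoints f.1 := by
    change X = (SST Sg).comp f.1 ((SST Sg).pair X ((SST Sg).one p))
    rw [SST.pair_one]
    refine funext fun i => ?_
    change X i = SimClass.comp (f.1 i) (SimClass.withExits fun i =>
      SimClass.ofGraph (daggerGraph F i))
    rw [SimClass.withExits_ofGraph, ← h3, SimClass.comp_ofGraph]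
    exact SimClass.ofGraph_eq_iff.2 ⟨le_comp_dagger F i, comp_dagger_le F i⟩
  have hle := (SST.dagger_isLeast Sg f.1).2 hfix
  refine T.le_of_inj fun i => ?_
  refine ((T.inj_tup _ i).trans_le ?_).trans (interp_daggerGraph_le hT (φ := φ) F (y := y) ?_ i)
  · rw [SRST.coe_dagger, ← interpClass_ofGraph]
    have hi : SimClass.sum ((SST Sg).dagger f.1 i) (SimClass.ofGraph (daggerGraph F i)) =
      SimClass.ofGraph (daggerGraph F i) := congrFun hle i
    change T.add _ _ = _
    rw [← interpClass_sum, hi]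
  · intro j
    have hy' : y = T.comp ((lift hT φ).map f) (T.pair y (T.one p)) := hy
    rw [← interpClass_ofGraph, h3]
    conv_lhs => rw [hy', ← T.comp_assoc]
    exact congrArg (fun k => T.comp k _) (T.inj_tup _ j)

end IdemGroveTheory

/-! ### Regular trees as solutions of finite systems -/

namespace SyncGraph

variable {Sg : ℕ → Type u} {p : ℕ}

/-- The graph `G` with another root. -/
def withRoot (G : SyncGraph Sg p) (v : G.V) : SyncGraph Sg p :=
  { G with root := v }

theorem sim_withRoot (G : SyncGraph Sg p) (v w u : G.V) : Sim (G.withRoot v) (G.withRoot w) u u :=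
  sim_refl G u

/-- The edges of `G` that start at `v`. -/
noncomputable def edgesAt (G : SyncGraph Sg p) [Finite G.E] (v : G.V) : List G.E :=
  (Set.toFinite {e | G.src e = v}).toFinset.toList

theorem mem_edgesAt {G : SyncGraph Sg p} [Finite G.E] {v : G.V} {e : G.E} :
    e ∈ G.edgesAt v ↔ G.src e = v := by
  simp [edgesAt]

theorem letterGraph_comp_le_iff {n : ℕ} {σ : Sg n} {H : Fin n → SyncGraph Sg p}
    {K : SyncGraph Sg p} :
    (compGraph (letterGraph σ) H).SimLE K ↔ ∃ ws, K.Step K.root (.letter ⟨n, σ⟩) ws ∧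
      List.Forall₂ (fun i w => Sim (H i) K (H i).root w) (List.finRange n) ws := by
  have hsome : ∀ (i : Fin n) (w : K.V),
      Sim (compGraph (letterGraph σ) H) K (compL (letterGraph σ) H (some i)) w ↔
        Sim (H i) K (H i).root w := by
    refine fun i w => ⟨fun h => h.comp_inl (letter_step_some.2 ⟨rfl, rfl⟩), fun h => ?_⟩
    refine Sim.trans (sim_of_step fun a us hs => ?_) h
    obtain ⟨τ, us, h1, rfl, rfl⟩ | ⟨j, us, h1, h2, rfl⟩ := comp_step_inl.1 hs
    · cases (letter_step_some.1 h1).1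
    · cases (letter_step_some.1 h1).1
      exact ⟨us, h2, forall₂_map_left (fun v => comp_inr_sim _ _ _ v) _⟩
  rw [simLE_iff]
  constructor
  · intro h
    obtain ⟨ws, h1, h2⟩ := localSim_sim _ _ _ _ h (.letter ⟨n, σ⟩) _
      (comp_step_inl.2 (Or.inl ⟨⟨n, σ⟩, _, letter_step_none.2 ⟨rfl, rfl⟩, rfl, rfl⟩))
    exact ⟨ws, h1, (List.forall₂_map_left_iff.1 (List.forall₂_map_left_iff.1 h2)).imp
      fun i w h => (hsome i w).1 h⟩
  · rintro ⟨ws, h1, h2⟩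
    refine sim_of_step fun a us hs => ?_
    obtain ⟨τ, us, h3, rfl, rfl⟩ | ⟨j, us, h3, h4, rfl⟩ := comp_step_inl.1 hs
    · obtain ⟨h5, rfl⟩ := letter_step_none.1 h3
      cases h5
      exact ⟨ws, h1, List.forall₂_map_left_iff.2 (List.forall₂_map_left_iff.2
        (h2.imp fun i w h => (hsome i w).2 h))⟩
    · cases (letter_step_none.1 h3).1

theorem exitGraph_le_iff {i : Fin p} {K : SyncGraph Sg p} :
    (exitGraph Sg i).SimLE K ↔ K.Step K.root (.exit i) [] := by
  rw [simLE_iff]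
  constructor
  · intro h
    obtain ⟨ws, h1, h2⟩ := localSim_sim _ _ _ _ h _ _ (exit_step.2 ⟨rfl, rfl⟩)
    cases h2
    exact h1
  · intro h
    refine sim_of_step fun a us hs => ?_
    obtain ⟨rfl, rfl⟩ := exit_step.1 hs
    exact ⟨[], h, List.Forall₂.nil⟩

end SyncGraph

namespace SRST

open SyncGraph IdemGroveTheory

variable {Sg : ℕ → Type u} {n p : ℕ}

theorem le_iff {f g : (SRST Sg).Hom 1 p} {G H : SyncGraph Sg p}
    (hG : SimClass.ofGraph G = f.1 0) (hH : SimClass.ofGraph H = g.1 0) :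
    f ≤ g ↔ G.SimLE H := by
  rw [← SimClass.sum_eq_iff, hG, hH]
  constructor
  · intro h
    exact congrFun (congrArg Subtype.val (show (SRST Sg).add f g = g from h)) 0
  · intro h
    refine Subtype.ext (funext fun i => ?_)
    obtain rfl := Subsingleton.elim i 0
    exact h

/-- The letters, as an interpretation of `Sg` in `SRST Sg`. -/
noncomputable def letters (Sg : ℕ → Type u) (n : ℕ) (σ : Sg n) : (SRST Sg).Hom 1 n :=
  letter σ

/-- The tree with one edge from the root, labeled `a`, whose targets carry the trees of the graphs
`Y u`, is below the tree of `K` if and only if `K` has a matching edge at its root. -/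
theorem ev_letters_le_iff {α : Type*} {a : Label Sg p} {us : List α}
    (hus : us.length = a.rank) {x : α → (SRST Sg).Hom 1 p} {Y : α → SyncGraph Sg p}
    (hY : ∀ u, SimClass.ofGraph (Y u) = (x u).1 0) {b : (SRST Sg).Hom 1 p} {K : SyncGraph Sg p}
    (hK : SimClass.ofGraph K = b.1 0) :
    (SRST Sg).ev (letters Sg) a (us.map x) ≤ b ↔ ∃ ws, K.Step K.root a ws ∧
      List.Forall₂ (fun u w => Sim (Y u) K (Y u).root w) us ws := by
  cases a with
  | exit i =>
    obtain rfl := List.length_eq_zero_iff.1 hus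
    rw [le_iff (G := exitGraph Sg i) rfl hK, exitGraph_le_iff]
    constructor
    · exact fun h => ⟨[], h, List.Forall₂.nil⟩
    · rintro ⟨_, h, h'⟩
      cases h'
      exact h
  | letter σ =>
    obtain ⟨m, σ⟩ := σ
    obtain rfl : us.length = m := hus
    have hG : SimClass.ofGraph (compGraph (letterGraph σ) fun i => Y us[i]) =
        ((SRST Sg).ev (letters Sg) (.letter ⟨us.length, σ⟩) (us.map x)).1 0 := by
      rw [← SimClass.comp_ofGraph]
      refine congrArg (SimClass.comp _) (funext fun i => ?_)
      change _ = ((us.map x).getD i _).1 0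
      simp [List.getD_eq_getElem?_getD, hY]
    rw [le_iff hG hK, letterGraph_comp_le_iff]
    refine exists_congr fun ws => and_congr_right fun _ => ?_
    have hmap := List.forall₂_map_left_iff (f := us.get) (l := List.finRange us.length) (u := ws)
      (R := fun u w => Sim (Y u) K (Y u).root w)
    rw [List.map_get_finRange] at hmap
    exact hmap.symm

/-- The tree obtained by unfolding a finite graph from a vertex. -/
noncomputable def vertexClass (G : SyncGraph Sg p) [Finite G.V] [Finite G.E] (v : G.V) :
    (SRST Sg).Hom 1 p :=
  ⟨fun _ => SimClass.ofGraph (G.withRoot v), fun _ => SimClass.isRegular_iff.2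
    ⟨G.withRoot v, inferInstanceAs (Finite G.V), inferInstanceAs (Finite G.E), rfl⟩⟩

variable {G : SyncGraph Sg p} [Finite G.V] [Finite G.E]

theorem vertexClass_isModel : (SRST Sg).IsModel (letters Sg) G (vertexClass G) := by
  intro v a ws hs
  rw [ev_letters_le_iff hs.length (Y := fun u => G.withRoot u) (fun _ => rfl)
    (K := G.withRoot v) rfl]
  exact ⟨ws, hs, List.forall₂_same.2 fun u _ => sim_withRoot G u v u⟩

theorem vertexClass_le_of_step {v : G.V} {b : (SRST Sg).Hom 1 p}
    (h : ∀ a ws, G.Step v a ws → (SRST Sg).ev (letters Sg) a (ws.map (vertexClass G)) ≤ b) :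
    vertexClass G v ≤ b := by
  obtain ⟨K, hK⟩ := (b.1 0).exists_graph
  rw [le_iff (G := G.withRoot v) rfl hK, simLE_iff]
  refine sim_of_step fun a us hs => ?_
  have hs' : G.Step v a us := hs
  exact (ev_letters_le_iff hs'.length (Y := fun u => G.withRoot u) (fun _ => rfl) hK).1
    (h a us hs)

theorem vertexClass_le_of_isModel {y : G.V → (SRST Sg).Hom 1 p}
    (hy : (SRST Sg).IsModel (letters Sg) G y) (v : G.V) : vertexClass G v ≤ y v := by
  choose Y hY using fun u => ((y u).1 0).exists_graph
  rw [le_iff (G := G.withRoot v) rfl (hY v), simLE_iff]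
  refine ⟨fun u w => Sim (Y u) (Y v) (Y u).root w, ?_, sim_refl (Y v) _⟩
  intro u w huw a us hs
  have hs' : G.Step u a us := hs
  obtain ⟨ws, h1, h2⟩ := (ev_letters_le_iff hs'.length hY (hY u)).1 (hy u a us hs)
  obtain ⟨ws', h3, h4⟩ := localSim_sim _ _ _ _ huw _ _ h1
  exact ⟨ws', h3, forall₂_trans (fun _ _ _ => Sim.trans) h2 h4⟩

end SRST

namespace IdemGroveTheory

open SyncGraph

section System

variable {Sg : ℕ → Type u} {n p : ℕ}

/-- The finite system of fixed point equations given by a finite graph, with an unknown for each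
vertex: it equates a vertex with the sum of the values of the edges that start at it. -/
noncomputable def system (S : IdemGroveTheory.{v}) (ψ : ∀ n : ℕ, Sg n → S.Hom 1 n)
    (G : SyncGraph Sg p) [Finite G.E] (κ : G.V ≃ Fin n) : S.Hom n (n + p) :=
  S.tup fun i => S.listSum ((G.edgesAt (κ.symm i)).map fun e =>
    S.ev ψ ((G.lab e).shift n) ((G.tgt e).map fun w => S.inj (Fin.castAdd p (κ w))))

theorem inj_system_comp (S : IdemGroveTheory.{v}) (ψ : ∀ n : ℕ, Sg n → S.Hom 1 n)
    (G : SyncGraph Sg p) [Finite G.E] (κ : G.V ≃ Fin n) (x : S.Hom n p) (i : Fin n) :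
    S.comp (S.inj i) (S.comp (S.system ψ G κ) (S.pair x (S.one p))) =
      S.listSum ((G.edgesAt (κ.symm i)).map fun e =>
        S.ev ψ (G.lab e) ((G.tgt e).map fun w => S.comp (S.inj (κ w)) x)) := by
  rw [← S.comp_assoc, system, S.inj_tup, listSum_comp, List.map_map]
  refine congrArg S.listSum (List.map_congr_left fun e _ => ?_)
  refine (S.ev_shift_comp ψ _ _ x).trans ?_
  rw [List.map_map]
  exact congrArg _ (List.map_congr_left fun w _ => S.inj_pair_left _ _ _)

namespace Morphism

variable {S : IdemGroveTheory.{v}} {T : IdemGroveTheory.{w}} (F : Morphism S T)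

theorem map_ev (ψ : ∀ n : ℕ, Sg n → S.Hom 1 n) (a : Label Sg p) (l : List (S.Hom 1 p)) :
    F.map (S.ev ψ a l) = T.ev (fun n σ => F.map (ψ n σ)) a (l.map F.map) := by
  cases a with
  | exit i => exact F.map_inj i
  | letter σ =>
    rw [ev, ev, F.map_comp, map_tup]
    refine congrArg (fun k => T.comp _ (T.tup k)) (funext fun i => ?_)
    rw [← F.map_zero]
    exact (List.getD_map (f := F.map) ..).symm

theorem map_listSum (l : List (S.Hom n p)) : F.map (S.listSum l) = T.listSum (l.map F.map) := by
  induction l with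
  | nil => exact F.map_zero n p
  | cons a l ih => exact (F.map_add _ _).trans (congrArg _ ih)

theorem map_system (ψ : ∀ n : ℕ, Sg n → S.Hom 1 n) (G : SyncGraph Sg p) [Finite G.E]
    (κ : G.V ≃ Fin n) :
    F.map (S.system ψ G κ) = T.system (fun n σ => F.map (ψ n σ)) G κ := by
  rw [system, map_tup]
  refine congrArg T.tup (funext fun i => ?_)
  rw [map_listSum, List.map_map]
  refine congrArg T.listSum (List.map_congr_left fun e _ => ?_)
  refine (F.map_ev ψ _ _).trans ?_
  rw [List.map_map]
  exact congrArg _ (List.map_congr_left fun w _ => F.map_inj _)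

end Morphism

/-- The trees of the vertices of a finite graph are the least solution of its system. -/
theorem dagger_system (G : SyncGraph Sg p) [Finite G.V] [Finite G.E] (κ : G.V ≃ Fin n) :
    (SRST Sg).dagger ((SRST Sg).system (SRST.letters Sg) G κ) =
      (SRST Sg).tup fun i => SRST.vertexClass G (κ.symm i) := by
  have hx : ∀ w, (SRST Sg).comp ((SRST Sg).inj (κ w))
      ((SRST Sg).tup fun i => SRST.vertexClass G (κ.symm i)) = SRST.vertexClass G w := by
    intro w
    rw [(SRST Sg).inj_tup, κ.symm_apply_apply]
  refine (SRST Sg).dagger_eq ⟨(SRST Sg).hom_ext fun i => ?_, fun y hy =>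
    (SRST Sg).le_of_inj fun i => ?_⟩
  · rw [inj_system_comp, (SRST Sg).inj_tup]
    simp only [hx]
    apply le_antisymm
    · refine SRST.vertexClass_le_of_step ?_
      rintro _ _ ⟨e, he, rfl, rfl⟩
      exact (SRST Sg).listSum_le_iff.1 le_rfl _ (List.mem_map_of_mem (mem_edgesAt.2 he))
    · refine (SRST Sg).listSum_le_iff.2 fun f hf => ?_
      obtain ⟨e, he, rfl⟩ := List.mem_map.1 hf
      exact SRST.vertexClass_isModel _ _ _ ⟨e, mem_edgesAt.1 he, rfl, rfl⟩
  · have hy' : ∀ i, (SRST Sg).comp ((SRST Sg).inj i) y = _ := fun i =>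
      (congrArg ((SRST Sg).comp ((SRST Sg).inj i)) hy).trans
        (inj_system_comp _ (SRST.letters Sg) G κ y i)
    rw [(SRST Sg).inj_tup]
    have h := SRST.vertexClass_le_of_isModel (G := G)
      (y := fun w => (SRST Sg).comp ((SRST Sg).inj (κ w)) y) ?_ (κ.symm i)
    · simpa only [κ.apply_symm_apply] using h
    · rintro _ _ _ ⟨e, rfl, rfl, rfl⟩
      dsimp only
      rw [hy' (κ (G.src e)), κ.symm_apply_apply]
      exact (SRST Sg).listSum_le_iff.1 le_rfl _ (List.mem_map_of_mem (mem_edgesAt.2 rfl))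

/-- A morphism that preserves dagger is determined by its values on the letters, because each
regular tree is a component of the dagger of the system of a finite graph, and such a system is
built from letters and distinguished morphisms by composition, tupling and sums. -/
theorem Morphism.ext_of_letter {T : IdemGroveTheory.{v}} {F F' : Morphism (SRST Sg) T}
    (hF : F.PreservesDagger) (hF' : F'.PreservesDagger)
    (h : ∀ (n : ℕ) (σ : Sg n), F.map (SRST.letter σ) = F'.map (SRST.letter σ)) : F = F' := by
  have h1 : ∀ (p : ℕ) (f : (SRST Sg).Hom 1 p), F.map f = F'.map f := by
    intro p f
    obtain ⟨G, _, _, hGf⟩ := SimClass.isRegular_iff.1 (f.2 0)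
    obtain ⟨n, ⟨κ⟩⟩ := Finite.exists_equiv_fin G.V
    have hf : f = (SRST Sg).comp ((SRST Sg).inj (κ G.root))
        ((SRST Sg).dagger ((SRST Sg).system (SRST.letters Sg) G κ)) := by
      rw [dagger_system, (SRST Sg).inj_tup, κ.symm_apply_apply]
      refine Subtype.ext (funext fun i => ?_)
      obtain rfl := Subsingleton.elim i 0
      exact hGf.symm
    have hl : (fun n σ => F.map (SRST.letters Sg n σ)) = fun n σ => F'.map (SRST.letters Sg n σ) :=
      funext fun n => funext fun σ => h n σ
    rw [hf, F.map_comp, F'.map_comp, F.map_inj, F'.map_inj, hF, hF', F.map_system, F'.map_system,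
      hl]
  have h2 : @Morphism.map _ _ F = @Morphism.map _ _ F' := by
    funext n p f
    refine T.hom_ext fun i => ?_
    rw [← F.map_inj, ← F.map_comp, F.map_inj, ← F'.map_inj, ← F'.map_comp, h1]
  cases F
  cases F'
  cases h2
  rfl

end System

end IdemGroveTheory

end Grove

theorem mainTheorem6 (Sg : ℕ → Type u) (T : Grove.IdemGroveTheory.{v}) (hT : T.IsOmegaContinuous)
    (φ : ∀ n : ℕ, Sg n → T.Hom 1 n) :
    ∃! F : Grove.IdemGroveTheory.Morphism (Grove.SRST Sg) T,
      F.PreservesDagger ∧ ∀ (n : ℕ) (σ : Sg n), F.map (Grove.SRST.letter σ) = φ n σ :=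
  ⟨Grove.IdemGroveTheory.lift hT φ,
    ⟨Grove.IdemGroveTheory.lift_preservesDagger hT φ,
      fun _ σ => Grove.IdemGroveTheory.lift_letter hT φ σ⟩,
    fun _ hF => Grove.IdemGroveTheory.Morphism.ext_of_letter hF.1
      (Grove.IdemGroveTheory.lift_preservesDagger hT φ) fun n σ =>
        (hF.2 n σ).trans (Grove.IdemGroveTheory.lift_letter hT φ σ).symm⟩
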